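/- Let $\omega_1,\omega_2\in\mathbb C$ be linearly independent over $\mathbb R$, $\Lambda=\omega_1\mathbb Z+\omega_2\mathbb Z$, $\Omega=\{t\omega_1+s\omega_2: |t|,|s|<\tfrac12\}$ and $2\Omega=\{t\omega_1+s\omega_2:|t|,|s|<1\}$. Let $G(z,p)=G(z-p)$ be the $\Lambda$-periodic Green function, $-\Delta G=\delta_0-\frac1{|\Omega|}$ in $\Omega$, $\int_\Omega G=0$, with regular part $H(z)=G(z)+\frac1{2\pi}\log|z|$, smooth in $2\Omega$, and let $\wp$ be the Weierstrass function of $\Lambda$. Consider a finite set $V\subset\overline\Omega$ of vortex points with multiplicities $m_p\in\mathbb N$ ($p\in V$; null multiplicities are allowed) which is * periodic: if $p\in V$, $q\in\overline\Omega$ and $q-p\in\Lambda$, then $q\in V$ and $m_q=m_p$; * even: for each $p\in V$ there is $q\in V$ with $q+p\in\Lambda$ and $m_q=m_p$. Assume that $0\in V$, with multiplicity $n=m_0$, and that $m_p$ is even when $p\in V\cap\{\frac{\omega_1}2,\frac{\omega_2}2,\frac{\omega_1+\omega_2}2\}$. Let $J\subset V\setminus\{0\}$ contain exactly one representative modulo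 $\Lambda$ of each point of $V\setminus\{0\}$, and assume the balance condition $n+\sum_{j\in J}m_j=2(n+1)$. Let $I\subset J$ be a minimal subset such that every point of $J$ is congruent modulo $\Lambda$ to $k$ or $-k$ for some $k\in I$, and put $\hat n_k=m_k/2$ if $k$ is a half-period (that is, $2k\in\Lambda$) and $\hat n_k=m_k$ otherwise. **The coefficient $D_0$.** Given $\tau\in\Omega$ and points $p_j$ ($j\in J$), put $u_0(z)=-4\pi nG(z,\tau)-4\pi\sum_{j\in J}m_jG(z,p_j)$. Let $\mathcal H_0$ be a meromorphic function in $\Omega$, with $\tau$ as its only pole, such that $|\mathcal H_0|^2=e^{u_0+8\pi(n+1)G(\cdot,\tau)}$, and let $\sigma_0=-\left(\int^z\mathcal H_0(w)\,dw\right)^{-1}$, with any constant of integration. A number $D$ is called the coefficient $D_0$ of the configuration if such $\mathcal H_0,\sigma_0$ exist and, for every choice of them and all sufficiently small $\rho>0$, the first integral below converges and $$D=\frac1\pi\left[\int_{\Omega\setminus\sigma_0^{-1}(B_\rho(0))}e^{u_0+8\pi(n+1)G(z,\tau)}\,dz-\int_{\mathbb R^2\setminus B_\rho(0)}\frac{n+1}{|y|^4}\,dy\right].$$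 **Proposition.** Let $$\mathcal H_0(z)=\lambda_0\prod_{k\in I}(\wp(z)-\wp(k))^{\hat n_k},\qquad \lambda_0=e^{2\pi(n+2)H(0)-2\pi\sum_{j\in J}m_jG(0,j)} .$$ 1. $|\mathcal H_0(z)|^2=e^{u_0(z)+8\pi(n+1)G(z,0)}$, where $u_0(z)=-4\pi nG(z,0)-4\pi\sum_{j\in J}m_jG(z,j)$, for all $z\in\mathbb C$ outside $\Lambda\cup(J+\Lambda)$. The meromorphic functions in $\Omega$ whose only pole is at $0$ and which satisfy this identity there are exactly the functions $c\,\mathcal H_0$ with $|c|=1$. Moreover $\mathcal H_0$ has a single-valued antiderivative in $2\Omega\setminus\{0\}$, so that $\sigma_0=-\left(\int^z\mathcal H_0\right)^{-1}$ is well defined in $2\Omega$. 2. There are a real number $D_0$ and a $\delta>0$ with the following properties. $D_0$ is the coefficient of the configuration with $\tau=0$ and $p_j=j$. For every $\tau\in\Omega$ with $|\tau|<\delta$ such that each $j+\tau$ ($j\in J$) is congruent modulo $\Lambda$ to a point $p_j\in\Omega$, the coefficient $D_0^\tau$ of the configuration with concentration point $\tau$ and remaining points $p_j$ equals $D_0$;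 in particular it does not depend on $\tau$. For every choice of the constant of integration in $\sigma_0$ and all sufficiently small $\rho>0$, $$\pi D_0^\tau=\pi D_0=\mathrm{Area}\left[\frac1{\sigma_0}\left(\Omega\setminus\sigma_0^{-1}(B_\rho(0))\right)\right]-(n+1)\,\mathrm{Area}\left(B_{1/\rho}(0)\right),$$ where the first area is finite and counted with multiplicity, i.e. it is $\int_{\mathbb C}\#\{z\in\Omega\setminus\sigma_0^{-1}(B_\rho(0)):\frac1{\sigma_0(z)}=w\}\,dw$. -/

import Mathlib

open MeasureTheory Filter Topology
open scoped ContDiff ENNReal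

noncomputable section

namespace TorusVortex

/-- The open parallelogram `{t ω₁ + s ω₂ : |t| < r, |s| < r}`. -/
def cell (L : PeriodPair) (r : ℝ) : Set ℂ :=
  {z | ∃ t s : ℝ, |t| < r ∧ |s| < r ∧ z = t * L.ω₁ + s * L.ω₂}

/-- The period cell `Ω`, centred at the origin. -/
def Omega (L : PeriodPair) : Set ℂ := cell L (1 / 2)

/-- The dilated cell `2Ω`; its only lattice point is `0`. -/
def twoOmega (L : PeriodPair) : Set ℂ := cell L 1

/-- `G` is the (doubly periodic, mean zero) Green function of `-Δ` on the torus with pole at the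
lattice, `-Δ G = δ₀ - 1/|Ω|`, and `H` is its regular part `G + (1/2π) log|z|` near the origin.
Since `-Δ (-(1/2π) log|z|) = δ₀`, the equation for `G` says that `H` is smooth with
`Δ H = 1/|Ω|`. The two-point Green function is `G(z, p) = G (z - p)`.
The value of `G` on the lattice carries no meaning. -/
structure IsGreenFunction (L : PeriodPair) (G H : ℂ → ℝ) : Prop where
  periodic : ∀ z : ℂ, ∀ l ∈ L.lattice, G (z + l) = G z
  decomp : ∀ z ∈ twoOmega L, z ≠ 0 → G z = -(1 / (2 * Real.pi)) * Real.log ‖z‖ + H z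
  smooth : ContDiffOn ℝ ∞ H (twoOmega L)
  laplacian : ∀ z ∈ twoOmega L, Laplacian.laplacian H z = 1 / volume.real (Omega L)
  mean_zero : ∫ z in Omega L, G z = 0

/-- A periodic vortex configuration in the closed cell: a finite set `V` of distinct points with
multiplicities `m`, such that all points of the closed cell congruent to a vortex point are vortex
points of the same multiplicity. -/
structure IsPeriodicConfiguration (L : PeriodPair) (V : Finset ℂ) (m : ℂ → ℕ) : Prop where
  mem_closure : ∀ p ∈ V, p ∈ closure (Omega L)
  periodic : ∀ p ∈ V, ∀ q ∈ closure (Omega L), q - p ∈ L.lattice → q ∈ V ∧ m q = m p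

/-- The configuration is even: `-p` is congruent to a vortex point of the same multiplicity. -/
def IsEvenConfiguration (L : PeriodPair) (V : Finset ℂ) (m : ℂ → ℕ) : Prop :=
  ∀ p ∈ V, ∃ q ∈ V, -p - q ∈ L.lattice ∧ m q = m p

/-- `J` picks exactly one representative, modulo the lattice, of each non-zero vortex point. -/
structure IsRepresentatives (L : PeriodPair) (V J : Finset ℂ) : Prop where
  subset : J ⊆ V
  ne_zero : (0 : ℂ) ∉ J
  distinct : ∀ i ∈ J, ∀ j ∈ J, i - j ∈ L.lattice → i = j
  cover : ∀ p ∈ V, p ≠ 0 → ∃ j ∈ J, p - j ∈ L.lattice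

/-- `I` is a minimal subset of `J` such that every point of `J` is congruent to `k` or `-k` for
some `k ∈ I`. -/
def IsHalfRepresentatives (L : PeriodPair) (J I : Finset ℂ) : Prop :=
  Minimal (fun K : Finset ℂ =>
    K ⊆ J ∧ ∀ j ∈ J, ∃ k ∈ K, j - k ∈ L.lattice ∨ j + k ∈ L.lattice) I

/-- `p` is a half-period: `2p` is a period but `p` is not. -/
def IsHalfPeriod (L : PeriodPair) (p : ℂ) : Prop := p ∉ L.lattice ∧ 2 * p ∈ L.lattice

open Classical in
/-- The exponent `n̂_k`: half the multiplicity at half-periods, the multiplicity elsewhere. -/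
def reducedMult (L : PeriodPair) (m : ℂ → ℕ) (k : ℂ) : ℕ :=
  if IsHalfPeriod L k then m k / 2 else m k

/-- `u₀(z) = -4π n G(z, τ) - 4π ∑_j m_j G(z, p_j)`. -/
def potential (G : ℂ → ℝ) (n : ℕ) (τ : ℂ) (J : Finset ℂ) (m : ℂ → ℕ) (p : ℂ → ℂ) (z : ℂ) : ℝ :=
  -4 * Real.pi * n * G (z - τ) - 4 * Real.pi * ∑ j ∈ J, (m j : ℝ) * G (z - p j)

/-- `exp (u₀(z) + 8π (n+1) G(z, τ))`. -/
def weight (G : ℂ → ℝ) (n : ℕ) (τ : ℂ) (J : Finset ℂ) (m : ℂ → ℕ) (p : ℂ → ℂ) (z : ℂ) : ℝ :=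
  Real.exp (potential G n τ J m p z + 8 * Real.pi * (n + 1) * G (z - τ))

/-- `K` is a meromorphic function `𝓗₀` in `Ω` with
`|𝓗₀|² = exp (u₀ + 8π (n+1) G(·, τ))`, its only pole being at `τ`. The identity is required away
from `τ` and the `p_j`, where the Green functions are infinite. -/
structure IsHZero (L : PeriodPair) (G : ℂ → ℝ) (n : ℕ) (τ : ℂ) (J : Finset ℂ) (m : ℂ → ℕ)
    (p : ℂ → ℂ) (K : ℂ → ℂ) : Prop where
  holo : DifferentiableOn ℂ K (Omega L \ {τ})
  mero : MeromorphicAt K τ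
  norm_sq : ∀ z ∈ Omega L, z ≠ τ → (∀ j ∈ J, z ≠ p j) → ‖K z‖ ^ 2 = weight G n τ J m p z

/-- `S = 1/σ₀` on `U`, where `σ₀ = -(∫^z 𝓗₀)⁻¹` and `𝓗₀ = K` has its only pole at `τ`: thus `S` is
the negative of an antiderivative of `K` on `U \ {τ}`, the constant of integration being
arbitrary. -/
def IsInvSigma (U : Set ℂ) (τ : ℂ) (K S : ℂ → ℂ) : Prop :=
  ∀ z ∈ U, z ≠ τ → HasDerivAt S (-K z) z

/-- `Ω \ σ₀⁻¹(B_ρ(0))` in terms of `S = 1/σ₀`. The point `τ`, where `σ₀ = 0`, is removed, and the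
poles of `σ₀`, where `S = 0`, are kept. -/
def truncated (L : PeriodPair) (τ : ℂ) (S : ℂ → ℂ) (ρ : ℝ) : Set ℂ :=
  {z | z ∈ Omega L ∧ z ≠ τ ∧ ‖S z‖ ≤ 1 / ρ}

/-- The expression
`(1/π) [∫_{Ω \ σ₀⁻¹(B_ρ(0))} e^{u₀ + 8π(n+1)G(z,τ)} - ∫_{ℝ² \ B_ρ(0)} (n+1)/|y|⁴]`. -/
def coefficientAt (L : PeriodPair) (G : ℂ → ℝ) (n : ℕ) (τ : ℂ) (J : Finset ℂ) (m : ℂ → ℕ)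
    (p : ℂ → ℂ) (S : ℂ → ℂ) (ρ : ℝ) : ℝ :=
  (1 / Real.pi) * ((∫ z in truncated L τ S ρ, weight G n τ J m p z) -
    ∫ y in (Metric.ball (0 : ℂ) ρ)ᶜ, ((n : ℝ) + 1) / ‖y‖ ^ 4)

/-- `D` is the coefficient `D₀` of the configuration with concentration point `τ` of multiplicity
`n` and remaining points `p_j`, `j ∈ J`, of multiplicities `m_j`: functions `𝓗₀` and `σ₀` exist,
and for every choice of them the defining expression is meaningful and equals `D` for all
sufficiently small `ρ > 0`. -/
def IsCoefficient (L : PeriodPair) (G : ℂ → ℝ) (n : ℕ) (τ : ℂ) (J : Finset ℂ) (m : ℂ → ℕ)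
    (p : ℂ → ℂ) (D : ℝ) : Prop :=
  (∃ K S : ℂ → ℂ, IsHZero L G n τ J m p K ∧ IsInvSigma (Omega L) τ K S) ∧
  ∀ K S : ℂ → ℂ, IsHZero L G n τ J m p K → IsInvSigma (Omega L) τ K S →
    ∀ᶠ ρ : ℝ in 𝓝[>] 0,
      IntegrableOn (weight G n τ J m p) (truncated L τ S ρ) ∧
      coefficientAt L G n τ J m p S ρ = D

/-- `λ₀ = exp (2π (n+2) H(0) - 2π ∑_j m_j G(0, p_j))`. -/
def lambdaZero (G H : ℂ → ℝ) (n : ℕ) (J : Finset ℂ) (m : ℂ → ℕ) : ℝ :=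
  Real.exp (2 * Real.pi * (n + 2) * H 0 - 2 * Real.pi * ∑ j ∈ J, (m j : ℝ) * G (0 - j))

/-- `λ₀ ∏_{k ∈ I} (℘(z) - ℘(p_k))^{n̂_k}`. -/
def explicitH (L : PeriodPair) (G H : ℂ → ℝ) (n : ℕ) (J I : Finset ℂ) (m : ℂ → ℕ) (z : ℂ) : ℂ :=
  (lambdaZero G H n J m : ℂ) *
    ∏ k ∈ I, (L.weierstrassP z - L.weierstrassP k) ^ reducedMult L m k

/-- The area of `S(A)` counted with multiplicity, `∫_ℂ #{z ∈ A : S z = w} dw`. -/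
def areaWithMultiplicity (S : ℂ → ℂ) (A : Set ℂ) : ℝ≥0∞ :=
  ∫⁻ w : ℂ, (({z | z ∈ A ∧ S z = w}.encard : ℕ∞) : ℝ≥0∞)

end TorusVortex

end

open TorusVortex

open TorusVortex

noncomputable section

namespace TorusVortex

/-! ### Plane topology and holomorphic functions -/

/-! The modulus identity comes from the maximum principle on the torus. The Green function,
corrected by `|z|² / (4|Ω|)` to absorb the background density, is locally the logarithm of the
modulus of a meromorphic function. In `2 G(z) - G(z-k) - G(z+k)` the quadratic corrections reduce to
a constant by the parallelogram law, and the poles and zeros match those of `℘(z) - ℘(k)`. Hence the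
quotient of `|℘(z) - ℘(k)|` by the exponential of `2π` times this combination is periodic and
locally the modulus of a holomorphic function, so it is constant. Letting `z → 0` gives the constant
(`norm_weierstrassP_sub`). In the product over `I`, evenness turns `∑_I n̂_k (φ(k) + φ(-k))` into
`∑_J m_j φ(j)` (`sum_half_representatives`), and `λ₀` cancels the remaining constants. Two
holomorphic functions of equal modulus on the connected punctured cell differ by a rotation. Since
`𝓗₀` is even with its only pole in `2Ω` at `0`, it has no residue there, whence the single-valued
antiderivative.

For the coefficient, `𝓗₀` has a pole of order `n + 2`, so `S = 1/σ₀` has one of order `n + 1` and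
takes every large value exactly `n + 1` times (`exists_radius_encard_eq`). Fix a large `R₀` and
split the truncated cell. Where `|S| > R₀`, the area formula gives `n + 1` times the area of a disc
of radius `1/ρ` minus that of a disc of radius `R₀`. The first of these is exactly the value of the
model integral of `(n+1)/|y|⁴`, and neither a rotation nor a constant added to `S` changes it. Where
`|S| ≤ R₀`, the integrand is periodic and the truncation can be made periodic, so the integral is
the same over every slightly translated cell (`integral_truncated`). The bracket is therefore
constant for small `ρ` and independent of `τ`; the area formula on the whole truncated cell gives
the geometric expression. -/

lemma isPreconnected_sdiff_singleton {U : Set ℂ} (hU : IsOpen U) (hc : Convex ℝ U) (τ : ℂ) :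
    IsPreconnected (U \ {τ}) := by
  by_cases hτ : τ ∈ U
  swap
  · rw [Set.sdiff_singleton_eq_self hτ]
    exact hc.isPreconnected
  obtain ⟨r, hr, hball⟩ := Metric.isOpen_iff.1 hU τ hτ
  have hmem : ∀ x y : ℝ, |x| ≤ r / 4 → |y| ≤ r / 4 → τ + (⟨x, y⟩ : ℂ) ∈ U := by
    intro x y hx hy
    apply hball
    rw [Metric.mem_ball, dist_eq_norm, add_sub_cancel_left]
    refine (Complex.norm_le_abs_re_add_abs_im _).trans_lt ?_
    simp only
    linarith
  have h4 : |r / 4| ≤ r / 4 := by rw [abs_of_pos (by positivity)]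
  have h4' : |-(r / 4)| ≤ r / 4 := by rw [abs_neg]; exact h4
  have hr4 : 0 < r / 4 := by positivity
  -- The four open half-planes bounded by the two coordinate lines through `τ` cover its complement.
  -- Each meets `U` in a convex set, and consecutive ones overlap at a diagonal point close to `τ`.
  have c1 : IsPreconnected (U ∩ {z | τ.re < z.re}) :=
    (hc.inter (convex_halfSpace_re_gt _)).isPreconnected
  have c2 : IsPreconnected (U ∩ {z | τ.im < z.im}) :=
    (hc.inter (convex_halfSpace_im_gt _)).isPreconnected
  have c3 : IsPreconnected (U ∩ {z | z.re < τ.re}) :=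
    (hc.inter (convex_halfSpace_re_lt _)).isPreconnected
  have c4 : IsPreconnected (U ∩ {z | z.im < τ.im}) :=
    (hc.inter (convex_halfSpace_im_lt _)).isPreconnected
  have k1 : IsPreconnected ((U ∩ {z | τ.re < z.re}) ∪ (U ∩ {z | τ.im < z.im})) :=
    IsPreconnected.union (τ + (⟨r / 4, r / 4⟩ : ℂ)) ⟨hmem _ _ h4 h4, by simpa using hr4⟩
      ⟨hmem _ _ h4 h4, by simpa using hr4⟩ c1 c2
  have k2 : IsPreconnected ((U ∩ {z | τ.re < z.re}) ∪ (U ∩ {z | τ.im < z.im}) ∪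
      (U ∩ {z | z.re < τ.re})) :=
    IsPreconnected.union (τ + (⟨-(r / 4), r / 4⟩ : ℂ))
      (Or.inr ⟨hmem _ _ h4' h4, by simpa using hr4⟩)
      ⟨hmem _ _ h4' h4, by simpa using hr4⟩ k1 c3
  have k3 : IsPreconnected ((U ∩ {z | τ.re < z.re}) ∪ (U ∩ {z | τ.im < z.im}) ∪
      (U ∩ {z | z.re < τ.re}) ∪ (U ∩ {z | z.im < τ.im})) :=
    IsPreconnected.union (τ + (⟨-(r / 4), -(r / 4)⟩ : ℂ))
      (Or.inr ⟨hmem _ _ h4' h4', by simpa using hr4⟩)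
      ⟨hmem _ _ h4' h4', by simpa using hr4⟩ k2 c4
  convert k3 using 1
  ext z
  simp only [Set.mem_sdiff, Set.mem_singleton_iff, Set.mem_union, Set.mem_inter_iff,
    Set.mem_ofPred_eq, Complex.ext_iff]
  constructor
  · rintro ⟨hz, h⟩
    by_cases h1 : z.re = τ.re
    · have h2 : z.im ≠ τ.im := fun h2 => h ⟨h1, h2⟩
      rcases h2.lt_or_gt with h2 | h2 <;> tauto
    · rcases lt_or_gt_of_ne h1 with h2 | h2 <;> tauto
  · rintro (((⟨hz, h⟩ | ⟨hz, h⟩) | ⟨hz, h⟩) | ⟨hz, h⟩) <;> refine ⟨hz, fun h' => ?_⟩ <;> linarith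

/-- An even holomorphic function is `g(0)` plus `z²` times an even holomorphic function. -/
lemma exists_even_quotient {U : Set ℂ} (hU : IsOpen U) (h0 : (0 : ℂ) ∈ U)
    {g : ℂ → ℂ} (hg : DifferentiableOn ℂ g U)
    (heven : ∀ z ∈ U, g (-z) = g z) :
    ∃ k : ℂ → ℂ, DifferentiableOn ℂ k U ∧ (∀ z ∈ U, k (-z) = k z) ∧
      ∀ z ∈ U, g z = g 0 + z ^ 2 * k z := by
  have hn : U ∈ 𝓝 (0 : ℂ) := hU.mem_nhds h0
  have hd1 : DifferentiableOn ℂ (dslope g 0) U := (Complex.differentiableOn_dslope hn).2 hg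
  have hd2 : DifferentiableOn ℂ (dslope (dslope g 0) 0) U :=
    (Complex.differentiableOn_dslope hn).2 hd1
  have e1 : ∀ z, z * dslope g 0 z = g z - g 0 := fun z => by
    simpa using sub_smul_dslope g 0 z
  -- Evenness kills the first derivative, so a second division by `z` is exact.
  have hderiv : dslope g 0 0 = 0 := by
    rw [dslope_same]
    have h1 : HasDerivAt g (deriv g 0) 0 := (hg.differentiableAt hn).hasDerivAt
    have h2 : HasDerivAt (fun z => g (-z)) (-deriv g 0) 0 := by
      have h1' : HasDerivAt g (deriv g 0) (-0) := by simpa using h1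
      exact (h1'.scomp (0 : ℂ) (hasDerivAt_neg (0 : ℂ))).congr_deriv (by simp)
    have h3 : (fun z => g (-z)) =ᶠ[𝓝 0] g := by
      filter_upwards [hn] with z hz using heven z hz
    have h4 := (h1.congr_of_eventuallyEq h3).unique h2
    have h5 : (2 : ℂ) * deriv g 0 = 0 := by linear_combination h4
    simpa using h5
  have e2 : ∀ z, z * dslope (dslope g 0) 0 z = dslope g 0 z := fun z => by
    have := sub_smul_dslope (dslope g 0) 0 z
    rwa [hderiv, sub_zero, sub_zero, smul_eq_mul] at this
  have e3 : ∀ z, g z = g 0 + z ^ 2 * dslope (dslope g 0) 0 z := fun z => by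
    linear_combination -(e1 z) - z * e2 z
  refine ⟨_, hd2, fun z hz => ?_, fun z _ => e3 z⟩
  by_cases h : z = 0
  · simp [h]
  · have := heven z hz
    rw [e3 z, e3 (-z)] at this
    have hz2 : z ^ 2 ≠ 0 := pow_ne_zero 2 h
    have h' : z ^ 2 * (dslope (dslope g 0) 0 (-z) - dslope (dslope g 0) 0 z) = 0 := by
      linear_combination this
    rcases mul_eq_zero.1 h' with h' | h'
    · exact absurd h' hz2
    · exact sub_eq_zero.1 h'

lemma hasDerivAt_inv_pow_succ (k : ℕ) {z : ℂ} (hz : z ≠ 0) :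
    HasDerivAt (fun z : ℂ => 1 / z ^ (k + 1)) (-(k + 1 : ℂ) / z ^ (k + 2)) z := by
  have h := (hasDerivAt_pow (k + 1) z).inv (pow_ne_zero _ hz)
  simp only [one_div]
  refine h.congr_deriv ?_
  simp only [Nat.add_sub_cancel]
  push_cast
  rw [neg_div, neg_div, ← pow_mul, show (k + 1) * 2 = (k + 2) + k by ring,
    pow_add z (k + 2) k, mul_div_mul_right _ _ (pow_ne_zero _ hz)]

/-- An even meromorphic function on a convex symmetric domain, with its only pole at the origin,
has a single-valued antiderivative. -/
lemma exists_primitive_of_even {U : Set ℂ} (hU : IsOpen U) (hc : Convex ℝ U) (h0 : (0 : ℂ) ∈ U)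
    (M : ℕ) : ∀ {g : ℂ → ℂ}, DifferentiableOn ℂ g U →
    (∀ z ∈ U, g (-z) = g z) →
    ∃ Q : ℂ → ℂ, DifferentiableOn ℂ Q U ∧ (2 * M + 1 : ℂ) * Q 0 = -g 0 ∧
      ∀ z ∈ U, z ≠ 0 →
        HasDerivAt (fun z => Q z / z ^ (2 * M + 1)) (g z / z ^ (2 * (M + 1))) z := by
  -- Write `g / z^(2M+2) = g(0) / z^(2M+2) + k / z^(2M)` with `k` even: the first term has an
  -- explicit primitive because its exponent is not `1`, and the second is the preceding case. For
  -- `M = 0`, `k` is holomorphic on a convex set. The value of `Q 0` is recorded to know the exact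
  -- order of the pole.
  induction M with
  | zero =>
    intro g hg heven
    obtain ⟨k, hk, -, hgk⟩ := exists_even_quotient hU h0 hg heven
    obtain ⟨P, hP⟩ := hc.exists_forall_hasDerivWithinAt hk
    have hP' : ∀ z ∈ U, HasDerivAt P (k z) z := fun z hz => (hP z hz).hasDerivAt (hU.mem_nhds hz)
    refine ⟨fun z => -g 0 + z * P z, ?_, by simp, fun z hz hz0 => ?_⟩
    · exact (differentiableOn_const _).add (differentiableOn_id.mul
        fun z hz => (hP' z hz).differentiableAt.differentiableWithinAt)
    · have h1 : HasDerivAt (fun z => -g 0 * (1 / z ^ (0 + 1)) + P z)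
          (-g 0 * (-((0 : ℕ) + 1 : ℂ) / z ^ (0 + 2)) + k z) z :=
        ((hasDerivAt_inv_pow_succ 0 hz0).const_mul _).add (hP' z hz)
      have h2 : HasDerivAt (fun z => (-g 0 + z * P z) / z ^ (2 * 0 + 1))
          (-g 0 * (-((0 : ℕ) + 1 : ℂ) / z ^ (0 + 2)) + k z) z := by
        refine h1.congr_of_eventuallyEq ?_
        filter_upwards [isOpen_ne.mem_nhds hz0] with w hw
        have hw' : w ≠ 0 := hw
        simp only [mul_zero, zero_add, pow_one]
        field_simp
      refine h2.congr_deriv ?_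
      rw [hgk z hz]
      simp only [zero_add, mul_one, Nat.cast_zero]
      field_simp
  | succ M ih =>
    intro g hg heven
    obtain ⟨k, hk, hkeven, hgk⟩ := exists_even_quotient hU h0 hg heven
    obtain ⟨Q, hQ, -, hQd⟩ := ih hk hkeven
    have hM : (2 * (M + 1) + 1 : ℂ) ≠ 0 := by
      have : ((2 * (M + 1) + 1 : ℕ) : ℂ) ≠ 0 := Nat.cast_ne_zero.2 (by omega)
      exact_mod_cast this
    refine ⟨fun z => -g 0 / (2 * (M + 1) + 1) + z ^ 2 * Q z, ?_, ?_, fun z hz hz0 => ?_⟩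
    · exact (differentiableOn_const _).add ((differentiableOn_id.pow 2).mul hQ)
    · push_cast
      field_simp
      ring
    · have h1 := ((hasDerivAt_inv_pow_succ (2 * M + 2) hz0).const_mul
        (-g 0 / (2 * (M + 1) + 1))).add (hQd z hz hz0)
      have h2 := h1.congr_of_eventuallyEq (f₁ := fun z =>
          (-g 0 / (2 * (M + 1) + 1) + z ^ 2 * Q z) / z ^ (2 * (M + 1) + 1)) (by
        filter_upwards [isOpen_ne.mem_nhds hz0] with w hw
        have hw' : w ≠ 0 := hw
        simp only [Pi.add_apply]
        rw [show 2 * (M + 1) + 1 = (2 * M + 1) + 2 by ring, show 2 * M + 2 + 1 = (2 * M + 1) + 2 by ring, pow_add]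
        field_simp)
      refine h2.congr_deriv ?_
      rw [hgk z hz]
      push_cast
      rw [show 2 * (M + 1 + 1) = (2 * (M + 1)) + 2 by ring,
        show 2 * M + 2 + 2 = (2 * (M + 1)) + 2 by ring, pow_add]
      have hz' : z ^ (2 * (M + 1)) ≠ 0 := pow_ne_zero _ hz0
      field_simp

/-- Holomorphic functions with the same modulus differ by a constant of modulus one. -/
lemma exists_eq_const_mul_of_norm_eq {U : Set ℂ} (hU : IsOpen U) (hc : IsPreconnected U)
    {f g : ℂ → ℂ} (hf : DifferentiableOn ℂ f U) (hg : DifferentiableOn ℂ g U)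
    (h : ∀ z ∈ U, ‖f z‖ = ‖g z‖) : ∃ c : ℂ, ‖c‖ = 1 ∧ ∀ z ∈ U, f z = c * g z := by
  by_cases hz : ∀ z ∈ U, g z = 0
  · refine ⟨1, by simp, fun z hzU => ?_⟩
    have := h z hzU
    rw [hz z hzU, norm_zero, norm_eq_zero] at this
    rw [this, hz z hzU, mul_zero]
  push Not at hz
  obtain ⟨z₀, hz₀, hg₀⟩ := hz
  have hfa := hf.analyticOnNhd hU
  have hga := hg.analyticOnNhd hU
  refine ⟨f z₀ / g z₀, by rw [norm_div, h z₀ hz₀, div_self (norm_ne_zero_iff.2 hg₀)], ?_⟩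
  have hev : ∀ᶠ z in 𝓝 z₀, z ∈ U ∧ g z ≠ 0 :=
    (hU.eventually_mem hz₀).and ((hga z₀ hz₀).continuousAt.eventually_ne hg₀)
  have hq : ∀ᶠ z in 𝓝 z₀, DifferentiableAt ℂ (fun z => f z / g z) z := by
    filter_upwards [hev] with z hz
    exact (hfa z hz.1).differentiableAt.div (hga z hz.1).differentiableAt hz.2
  -- The quotient has modulus one, so `z₀` is trivially a local maximum and the quotient is locally
  -- constant. The identity theorem then carries the relation across the zeros of `g`.
  have hmax : IsLocalMax (norm ∘ fun z => f z / g z) z₀ := by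
    filter_upwards [hev] with z hz
    simp only [Function.comp_apply, norm_div]
    rw [h z hz.1, h z₀ hz₀, div_self (norm_ne_zero_iff.2 hz.2), div_self (norm_ne_zero_iff.2 hg₀)]
  have hconst := Complex.eventually_eq_of_isLocalMax_norm hq hmax
  have := hfa.eqOn_of_preconnected_of_eventuallyEq
    (g := fun z => f z₀ / g z₀ * g z) (analyticOnNhd_const.mul hga) hc hz₀ (by
      filter_upwards [hconst, hev] with z hz hz'
      rw [← hz, div_mul_cancel₀ _ hz'.2])
  exact this

/-- Antiderivatives of the same function on a connected open set differ by a constant. -/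
lemma exists_eq_add_const {U : Set ℂ} (hU : IsOpen U) (hc : IsPreconnected U)
    {f g f' : ℂ → ℂ} (hf : ∀ z ∈ U, HasDerivAt f (f' z) z) (hg : ∀ z ∈ U, HasDerivAt g (f' z) z) :
    ∃ d : ℂ, ∀ z ∈ U, f z = g z + d := by
  rcases U.eq_empty_or_nonempty with rfl | ⟨z₀, hz₀⟩
  · exact ⟨0, by simp⟩
  refine ⟨f z₀ - g z₀, fun z hz => ?_⟩
  have := hU.eqOn_of_deriv_eq hc
    (f := f) (g := fun z => g z + (f z₀ - g z₀))
    (fun z hz => (hf z hz).differentiableAt.differentiableWithinAt)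
    (fun z hz => ((hg z hz).add_const _).differentiableAt.differentiableWithinAt)
    (fun z hz => by rw [(hf z hz).deriv, ((hg z hz).add_const _).deriv]) hz₀ (by simp)
  exact this hz

end TorusVortex

end

noncomputable section

namespace TorusVortex

/-! ### The area formula with multiplicity -/

lemma abs_det_smulRight_restrictScalars (a : ℂ) :
    |((ContinuousLinearMap.toSpanSingleton ℂ a).restrictScalars ℝ).det| = ‖a‖ ^ 2 := by
  simp [ContinuousLinearMap.det, LinearMap.det_restrictScalars,
    Algebra.norm_complex_eq, Complex.normSq_eq_norm_sq]

lemma lintegral_norm_sq_deriv_of_injOn {f f' : ℂ → ℂ} {A : Set ℂ} (hA : MeasurableSet A)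
    (hf : ∀ z ∈ A, HasDerivAt f (f' z) z) (hinj : Set.InjOn f A) :
    ∫⁻ z in A, ENNReal.ofReal (‖f' z‖ ^ 2) = volume (f '' A) := by
  rw [← lintegral_abs_det_fderiv_eq_addHaar_image volume hA
    (f' := fun z => (ContinuousLinearMap.toSpanSingleton ℂ (f' z)).restrictScalars ℝ)
    (fun z hz => ((hf z hz).hasFDerivAt.restrictScalars ℝ).hasFDerivWithinAt) hinj]
  simp_rw [abs_det_smulRight_restrictScalars]

/-- A complex derivative on an open set is automatically strict, so the inverse function theorem
applies off the critical points. -/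
lemma exists_injOn_nhds {f f' : ℂ → ℂ} {W : Set ℂ} (hW : IsOpen W)
    (hf : ∀ z ∈ W, HasDerivAt f (f' z) z) {z : ℂ} (hz : z ∈ W) (hz' : f' z ≠ 0) :
    ∃ O : Set ℂ, IsOpen O ∧ O ⊆ W ∧ Set.InjOn f O ∧ z ∈ O := by
  have ha : AnalyticAt ℂ f z :=
    DifferentiableOn.analyticAt (fun w hw => (hf w hw).differentiableAt.differentiableWithinAt)
      (hW.mem_nhds hz)
  have hs : HasStrictDerivAt f (f' z) z := by
    have := ha.hasStrictDerivAt
    rwa [(hf z hz).deriv] at this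
  let e := hs.hasStrictFDerivAt_equiv hz' |>.toOpenPartialHomeomorph f
  exact ⟨e.source ∩ W, e.open_source.inter hW, Set.inter_subset_right,
    e.injOn.mono Set.inter_subset_left,
    (hs.hasStrictFDerivAt_equiv hz').mem_toOpenPartialHomeomorph_source, hz⟩

/-- Each piece contains at most one preimage of `w`, and counting measure is countably additive over
the disjoint pieces. -/
lemma tsum_indicator_image_eq_encard {f : ℂ → ℂ} {A : ℕ → Set ℂ} (hd : Pairwise (Function.onFun Disjoint A))
    (hinj : ∀ n, Set.InjOn f (A n)) (w : ℂ) :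
    ∑' n, (f '' A n).indicator (1 : ℂ → ℝ≥0∞) w =
      (({z | z ∈ ⋃ n, A n ∧ f z = w}.encard : ℕ∞) : ℝ≥0∞) := by
  have hsub : ∀ n, ({z | z ∈ A n ∧ f z = w}).Subsingleton := fun n x hx y hy =>
    hinj n hx.1 hy.1 (hx.2.trans hy.2.symm)
  have hmeas : ∀ n, MeasurableSet {z | z ∈ A n ∧ f z = w} := fun n => (hsub n).measurableSet
  have hU : {z | (z ∈ ⋃ n, A n) ∧ f z = w} = ⋃ n, {z | z ∈ A n ∧ f z = w} := by
    ext z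
    simp
  rw [hU, ← Measure.count_apply (MeasurableSet.iUnion hmeas), measure_iUnion ?_ hmeas]
  · refine tsum_congr fun n => ?_
    rw [Measure.count_apply (hmeas n)]
    by_cases h : w ∈ f '' A n
    · obtain ⟨z, hz, rfl⟩ := h
      have : {y | y ∈ A n ∧ f y = f z} = {z} :=
        (hsub n).eq_singleton_of_mem ⟨hz, rfl⟩
      rw [Set.indicator_of_mem (Set.mem_image_of_mem f hz), this]
      simp
    · have : {y | y ∈ A n ∧ f y = w} = ∅ := by
        ext y
        simp only [Set.mem_ofPred_eq, Set.mem_empty_iff_false, iff_false]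
        exact fun hy => h ⟨y, hy.1, hy.2⟩
      rw [Set.indicator_of_notMem h, this]
      simp
  · intro i j hij
    refine Set.disjoint_left.2 fun z hz hz' => ?_
    exact Set.disjoint_left.1 (hd hij) hz.1 hz'.1

/-- The area formula for a holomorphic function with countably many critical points. -/
lemma areaWithMultiplicity_eq_lintegral {f f' : ℂ → ℂ} {W A : Set ℂ} (hW : IsOpen W)
    (hf : ∀ z ∈ W, HasDerivAt f (f' z) z) (hcrit : {z | z ∈ W ∧ f' z = 0}.Countable)
    (hA : MeasurableSet A) (hAW : A ⊆ W) :
    areaWithMultiplicity f A = ∫⁻ z in A, ENNReal.ofReal (‖f' z‖ ^ 2) := by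
  classical
  set C := {z | z ∈ W ∧ f' z = 0} with hC
  have hO : ∀ z, ∃ O : Set ℂ, IsOpen O ∧ O ⊆ W ∧ Set.InjOn f O ∧ (z ∈ W \ C → z ∈ O) := by
    intro z
    by_cases hz : z ∈ W \ C
    · obtain ⟨O, h1, h2, h3, h4⟩ := exists_injOn_nhds hW hf hz.1 (fun h => hz.2 ⟨hz.1, h⟩)
      exact ⟨O, h1, h2, h3, fun _ => h4⟩
    · exact ⟨∅, isOpen_empty, Set.empty_subset _, by simp, fun h => absurd h hz⟩
  choose O hO1 hO2 hO3 hO4 using hO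
  -- By the Lindelöf property countably many injectivity neighbourhoods suffice; making them
  -- disjoint cuts `A \ C` into measurable pieces on which the classical change of variables holds.
  obtain ⟨t, -, htc, ht⟩ := TopologicalSpace.countable_cover_nhdsWithin (s := W \ C) (f := O)
    fun z hz => mem_nhdsWithin_of_mem_nhds ((hO1 z).mem_nhds (hO4 z hz))
  obtain ⟨u, hu⟩ := Set.countable_iff_exists_subset_range.1 htc
  set B : ℕ → Set ℂ := fun n => (A \ C) ∩ disjointed (fun n => O (u n)) n with hB
  have hBm : ∀ n, MeasurableSet (B n) := fun n =>
    (hA.diff hcrit.measurableSet).inter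
      (MeasurableSet.disjointed (fun n => (hO1 (u n)).measurableSet) n)
  have hBinj : ∀ n, Set.InjOn f (B n) := fun n =>
    (hO3 (u n)).mono (Set.inter_subset_right.trans (disjointed_subset _ _))
  have hBd : Pairwise (Function.onFun Disjoint B) := fun i j hij =>
    (disjoint_disjointed _ hij).mono Set.inter_subset_right Set.inter_subset_right
  have hBU : ⋃ n, B n = A \ C := by
    rw [hB, ← Set.inter_iUnion, iUnion_disjointed]
    refine Set.inter_eq_left.2 fun z hz => ?_
    obtain ⟨x, hx, hzx⟩ := Set.mem_iUnion₂.1 (ht ⟨hAW hz.1, hz.2⟩)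
    obtain ⟨n, rfl⟩ := hu hx
    exact Set.mem_iUnion.2 ⟨n, hzx⟩
  have hBf : ∀ n, ∀ z ∈ B n, HasDerivAt f (f' z) z := fun n z hz => hf z (hAW hz.1.1)
  have hfBm : ∀ n, MeasurableSet (f '' B n) := fun n =>
    (hBm n).image_of_continuousOn_injOn
      (fun z hz => (hBf n z hz).continuousAt.continuousWithinAt) (hBinj n)
  have h1 : ∫⁻ z in A, ENNReal.ofReal (‖f' z‖ ^ 2) = ∫⁻ z in ⋃ n, B n, ENNReal.ofReal (‖f' z‖ ^ 2) := by
    rw [hBU]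
    refine setLIntegral_congr ?_
    exact (sdiff_null_ae_eq_self (hcrit.measure_zero volume)).symm
  rw [h1, lintegral_iUnion hBm hBd]
  simp_rw [fun n => lintegral_norm_sq_deriv_of_injOn (hBm n) (hBf n) (hBinj n)]
  have h2 : ∀ n, volume (f '' B n) = ∫⁻ w, (f '' B n).indicator (1 : ℂ → ℝ≥0∞) w := fun n =>
    (lintegral_indicator_one (hfBm n)).symm
  simp_rw [h2]
  rw [← lintegral_tsum fun n => (measurable_one.indicator (hfBm n)).aemeasurable]
  unfold areaWithMultiplicity
  refine lintegral_congr_ae ?_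
  -- The critical values form a countable, hence null, set, so dropping `C` does not affect the
  -- count of preimages either.
  have hnull : ∀ᵐ w : ℂ, w ∉ f '' C := (hcrit.image f).ae_notMem volume
  filter_upwards [hnull] with w hw
  rw [tsum_indicator_image_eq_encard hBd hBinj w, hBU]
  congr 3
  ext z
  exact ⟨fun h => ⟨⟨h.1, fun hz => hw ⟨z, hz, h.2⟩⟩, h.2⟩, fun h => ⟨h.1.1, h.2⟩⟩

/-! ### Preimages near a pole -/

lemma encard_pow_eq {N : ℕ} (hN : N ≠ 0) {a : ℂ} (ha : a ≠ 0) :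
    {z : ℂ | z ^ N = a}.encard = N := by
  classical
  have hprim := Complex.isPrimitiveRoot_exp N hN
  obtain ⟨r, hr⟩ := IsAlgClosed.exists_pow_nat_eq a (Nat.pos_of_ne_zero hN)
  have hr0 : r ≠ 0 := by
    rintro rfl
    rw [zero_pow hN] at hr
    exact ha hr.symm
  have : {z : ℂ | z ^ N = a} = (fun z => r * z) '' (Polynomial.nthRootsFinset N (1 : ℂ) : Set ℂ) := by
    ext z
    simp only [Set.mem_ofPred_eq, Set.mem_image, Finset.mem_coe,
      Polynomial.mem_nthRootsFinset (Nat.pos_of_ne_zero hN)]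
    constructor
    · intro hz
      refine ⟨z / r, ?_, by field_simp⟩
      rw [div_pow, hz, hr, div_self ha]
    · rintro ⟨y, hy, rfl⟩
      rw [mul_pow, hy, hr, mul_one]
  rw [this, (mul_right_injective₀ hr0).encard_image, Set.encard_coe_eq_coe_finsetCard,
    hprim.card_nthRootsFinset]

/-- A function with a pole of order `N` is locally `φ⁻ᴺ` for a local coordinate `φ`. -/
lemma exists_coordinate_at_pole {N : ℕ} (hN : N ≠ 0) {Q : ℂ → ℂ} (hQ : AnalyticAt ℂ Q 0)
    (hQ0 : Q 0 ≠ 0) : ∃ (φ : ℂ → ℂ) (a : ℂ), a ≠ 0 ∧ HasStrictDerivAt φ a 0 ∧ φ 0 = 0 ∧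
      ∀ᶠ z in 𝓝 0, Q z ≠ 0 ∧ φ z ^ N = z ^ N / Q z := by
  obtain ⟨r, hr⟩ := IsAlgClosed.exists_pow_nat_eq (Q 0)⁻¹ (Nat.pos_of_ne_zero hN)
  have hr0 : r ≠ 0 := by
    rintro rfl
    rw [zero_pow hN] at hr
    exact inv_ne_zero hQ0 hr.symm
  -- `Q(0)/Q` equals `1` at the origin, so its `N`-th root is analytic there through the principal
  -- logarithm; `r` supplies the root of `1/Q(0)`.
  have hu : AnalyticAt ℂ (fun z => Q 0 / Q z) 0 := analyticAt_const.div hQ hQ0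
  have hlog : AnalyticAt ℂ (fun z => Complex.log (Q 0 / Q z)) 0 :=
    hu.clog (by rw [div_self hQ0]; exact Complex.one_mem_slitPlane)
  have hψ : AnalyticAt ℂ (fun z => r * Complex.exp (Complex.log (Q 0 / Q z) / N)) 0 :=
    analyticAt_const.mul ((hlog.div analyticAt_const (Nat.cast_ne_zero.2 hN)).cexp)
  have hφ : AnalyticAt ℂ (fun z => z * (r * Complex.exp (Complex.log (Q 0 / Q z) / N))) 0 :=
    analyticAt_id.mul hψ
  refine ⟨fun z => z * (r * Complex.exp (Complex.log (Q 0 / Q z) / N)), r, hr0, ?_, by simp, ?_⟩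
  · have h1 := hφ.hasStrictDerivAt
    have h2 := ((hasDerivAt_id (0 : ℂ)).mul hψ.differentiableAt.hasDerivAt).deriv
    have h3 : deriv (fun z => z * (r * Complex.exp (Complex.log (Q 0 / Q z) / N))) 0 = r := by
      refine Eq.trans h2 ?_
      simp [div_self hQ0]
    rwa [h3] at h1
  · filter_upwards [hQ.continuousAt.eventually_ne hQ0] with z hz
    refine ⟨hz, ?_⟩
    rw [mul_pow, mul_pow, hr, ← Complex.exp_nat_mul, mul_div_cancel₀ _ (Nat.cast_ne_zero.2 hN),
      Complex.exp_log (div_ne_zero hQ0 hz)]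
    field_simp

/-- Near infinity, a function with a pole of order `N` takes each value exactly `N` times. -/
lemma exists_radius_encard_eq {N : ℕ} (hN : N ≠ 0) {S Q : ℂ → ℂ} {T V : Set ℂ}
    (hQ : AnalyticAt ℂ Q 0) (hQ0 : Q 0 ≠ 0) (hS : ∀ᶠ z in 𝓝[≠] 0, S z = Q z / z ^ N)
    (hT : T ∈ 𝓝 0) (hV : V ∈ 𝓝 0)
    (hb : ∀ O ∈ 𝓝 (0 : ℂ), IsOpen O → ∃ B : ℝ, ∀ z ∈ T \ O, ‖S z‖ ≤ B) :
    ∃ R : ℝ, 0 < R ∧ (∀ z ∈ T, z ≠ 0 → R < ‖S z‖ → z ∈ V) ∧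
      ∀ w : ℂ, R < ‖w‖ → {z | z ∈ T ∧ z ≠ 0 ∧ S z = w}.encard = N := by
  obtain ⟨φ, a, ha, hφ, hφ0, hφN⟩ := exists_coordinate_at_pole hN hQ hQ0
  rw [eventually_nhdsWithin_iff] at hS
  obtain ⟨O, hO, hOo, h0O⟩ := eventually_nhds_iff.1 ((hS.and hφN).and (Filter.inter_mem hT hV))
  let e₀ := (hφ.hasStrictFDerivAt_equiv ha).toOpenPartialHomeomorph φ
  have he₀ : (0 : ℂ) ∈ e₀.source := (hφ.hasStrictFDerivAt_equiv ha).mem_toOpenPartialHomeomorph_source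
  let e := e₀.restr O
  have hes : e.source = e₀.source ∩ O := by
    rw [OpenPartialHomeomorph.restr_source, hOo.interior_eq]
  have hcoe : ∀ z, e z = φ z := fun z => rfl
  have h0e : (0 : ℂ) ∈ e.source := by rw [hes]; exact ⟨he₀, h0O⟩
  have h0t : (0 : ℂ) ∈ e.target := by
    have := e.map_source h0e
    rwa [hcoe, hφ0] at this
  obtain ⟨ε, hε, hball⟩ := Metric.isOpen_iff.1 e.open_target 0 h0t
  obtain ⟨B, hB⟩ := hb e.source (e.open_source.mem_nhds h0e) e.open_source
  have key : ∀ z ∈ e.source, z ≠ 0 → z ∈ T ∧ z ∈ V ∧ S z = (φ z ^ N)⁻¹ ∧ φ z ^ N ≠ 0 := by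
    intro z hz hz0
    rw [hes] at hz
    obtain ⟨⟨h1, h2, h3⟩, h4, h5⟩ := hO z hz.2
    refine ⟨h4, h5, ?_, ?_⟩
    · rw [h1 hz0, h3, inv_div]
    · rw [h3]
      exact div_ne_zero (pow_ne_zero _ hz0) h2
  -- `B` bounds `S` off the chart, so a larger value of `‖S z‖` forces `z` into it. Beyond `ε⁻ᴺ` all
  -- `N` roots of `ζ ^ N = w⁻¹` lie in the target of the chart, where `S = φ⁻ᴺ`.
  refine ⟨max B (ε ^ N)⁻¹, lt_max_of_lt_right (by positivity), fun z hz hz0 hzR => ?_,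
    fun w hw => ?_⟩
  · by_contra hzV
    have : z ∉ e.source := fun h => hzV (key z h hz0).2.1
    exact absurd (hB z ⟨hz, this⟩) (not_le.2 ((le_max_left _ _).trans_lt hzR))
  · have hw0 : w ≠ 0 := by
      rintro rfl
      rw [norm_zero] at hw
      exact absurd ((lt_max_of_lt_right (by positivity : 0 < (ε ^ N)⁻¹)).trans hw) (lt_irrefl _)
    have hpow : ∀ ζ : ℂ, ζ ^ N = w⁻¹ → ζ ∈ e.target := by
      intro ζ hζ
      apply hball
      rw [mem_ball_zero_iff]
      refine lt_of_pow_lt_pow_left₀ N hε.le ?_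
      rw [← norm_pow, hζ, norm_inv]
      exact inv_lt_of_inv_lt₀ (by positivity) ((le_max_right _ _).trans_lt hw)
    have hset : {z | z ∈ T ∧ z ≠ 0 ∧ S z = w} = e.symm '' {ζ : ℂ | ζ ^ N = w⁻¹} := by
      ext z
      constructor
      · rintro ⟨hzT, hz0, hzw⟩
        have hzs : z ∈ e.source := by
          by_contra h
          have := hB z ⟨hzT, h⟩
          rw [hzw] at this
          exact absurd this (not_le.2 ((le_max_left _ _).trans_lt hw))
        refine ⟨e z, ?_, e.left_inv hzs⟩
        obtain ⟨-, -, h1, h2⟩ := key z hzs hz0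
        change φ z ^ N = w⁻¹
        rw [← hzw, h1, inv_inv]
      · rintro ⟨ζ, hζ, rfl⟩
        have hζt := hpow ζ hζ
        have hφζ : φ (e.symm ζ) = ζ := e.right_inv hζt
        have hne : e.symm ζ ≠ 0 := by
          intro h
          rw [h, hφ0] at hφζ
          have : ζ ^ N = w⁻¹ := hζ
          rw [← hφζ, zero_pow hN] at this
          exact inv_ne_zero hw0 this.symm
        obtain ⟨h1, -, h2, -⟩ := key _ (e.map_target hζt) hne
        refine ⟨h1, hne, ?_⟩
        rw [h2, hφζ, show ζ ^ N = w⁻¹ from hζ, inv_inv]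
    rw [hset, Set.InjOn.encard_image, encard_pow_eq hN (inv_ne_zero hw0)]
    exact e.symm.injOn.mono fun ζ hζ => hpow ζ hζ

end TorusVortex

end

noncomputable section

namespace TorusVortex

/-! ### Lattice coordinates and cells -/

/-- The coefficient of `ω₁`. -/
def coordOne (L : PeriodPair) : ℂ →L[ℝ] ℝ := LinearMap.toContinuousLinearMap (L.basis.coord 0)

/-- The coefficient of `ω₂`. -/
def coordTwo (L : PeriodPair) : ℂ →L[ℝ] ℝ := LinearMap.toContinuousLinearMap (L.basis.coord 1)

variable (L : PeriodPair)

lemma coord_decomp (z : ℂ) : z = coordOne L z * L.ω₁ + coordTwo L z * L.ω₂ := by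
  have := L.basis.sum_repr z
  simp only [Fin.sum_univ_two, PeriodPair.basis_zero, PeriodPair.basis_one,
    Complex.real_smul] at this
  exact this.symm

lemma coordOne_combo (t s : ℝ) : coordOne L (t * L.ω₁ + s * L.ω₂) = t := by
  have h : (t * L.ω₁ + s * L.ω₂ : ℂ) = t • L.basis 0 + s • L.basis 1 := by simp
  rw [h, map_add, map_smul, map_smul]
  simp only [coordOne, LinearMap.coe_toContinuousLinearMap', Module.Basis.coord_apply,
    Module.Basis.repr_self]
  simp

lemma coordTwo_combo (t s : ℝ) : coordTwo L (t * L.ω₁ + s * L.ω₂) = s := by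
  have h : (t * L.ω₁ + s * L.ω₂ : ℂ) = t • L.basis 0 + s • L.basis 1 := by simp
  rw [h, map_add, map_smul, map_smul]
  simp only [coordTwo, LinearMap.coe_toContinuousLinearMap', Module.Basis.coord_apply,
    Module.Basis.repr_self]
  simp

variable {L}

lemma coord_ext {z w : ℂ} (h1 : coordOne L z = coordOne L w) (h2 : coordTwo L z = coordTwo L w) :
    z = w := by
  rw [coord_decomp L z, coord_decomp L w, h1, h2]

lemma mem_cell {r : ℝ} {z : ℂ} : z ∈ cell L r ↔ |coordOne L z| < r ∧ |coordTwo L z| < r := by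
  constructor
  · rintro ⟨t, s, ht, hs, rfl⟩
    rw [coordOne_combo, coordTwo_combo]
    exact ⟨ht, hs⟩
  · rintro ⟨h1, h2⟩
    exact ⟨_, _, h1, h2, coord_decomp L z⟩

lemma mem_lattice_iff {z : ℂ} :
    z ∈ L.lattice ↔ ∃ m n : ℤ, coordOne L z = m ∧ coordTwo L z = n := by
  rw [PeriodPair.mem_lattice]
  constructor
  · rintro ⟨m, n, rfl⟩
    refine ⟨m, n, ?_, ?_⟩
    · have := coordOne_combo L m n
      push_cast at this
      exact this
    · have := coordTwo_combo L m n
      push_cast at this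
      exact this
  · rintro ⟨m, n, h1, h2⟩
    refine ⟨m, n, ?_⟩
    conv_rhs => rw [coord_decomp L z, h1, h2]
    push_cast
    rfl

lemma isOpen_cell (r : ℝ) : IsOpen (cell L r) := by
  have : cell L r = {z | |coordOne L z| < r} ∩ {z | |coordTwo L z| < r} := by
    ext z
    exact mem_cell
  rw [this]
  exact (isOpen_lt (by fun_prop) (by fun_prop)).inter (isOpen_lt (by fun_prop) (by fun_prop))

lemma convex_cell (r : ℝ) : Convex ℝ (cell L r) := by
  have : cell L r = (coordOne L) ⁻¹' (Metric.ball 0 r) ∩ (coordTwo L) ⁻¹' (Metric.ball 0 r) := by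
    ext z
    simp [mem_cell]
  rw [this]
  exact ((convex_ball (0 : ℝ) r).linear_preimage (coordOne L).toLinearMap).inter
    ((convex_ball (0 : ℝ) r).linear_preimage (coordTwo L).toLinearMap)

lemma zero_mem_cell {r : ℝ} (hr : 0 < r) : (0 : ℂ) ∈ cell L r := by
  simp [mem_cell, hr]

lemma cell_mem_nhds {r : ℝ} (hr : 0 < r) : cell L r ∈ 𝓝 0 := (isOpen_cell r).mem_nhds (zero_mem_cell hr)

lemma neg_mem_cell {r : ℝ} {z : ℂ} (hz : z ∈ cell L r) : -z ∈ cell L r := by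
  simpa [mem_cell] using mem_cell.1 hz

lemma cell_mono {r s : ℝ} (h : r ≤ s) : cell L r ⊆ cell L s := fun _ hz =>
  mem_cell.2 ⟨(mem_cell.1 hz).1.trans_le h, (mem_cell.1 hz).2.trans_le h⟩

lemma add_mem_cell {r s : ℝ} {z w : ℂ} (hz : z ∈ cell L r) (hw : w ∈ cell L s) :
    z + w ∈ cell L (r + s) := by
  rw [mem_cell] at *
  rw [map_add, map_add]
  exact ⟨(abs_add_le _ _).trans_lt (by linarith), (abs_add_le _ _).trans_lt (by linarith)⟩

lemma sub_mem_cell {r s : ℝ} {z w : ℂ} (hz : z ∈ cell L r) (hw : w ∈ cell L s) :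
    z - w ∈ cell L (r + s) := by
  rw [sub_eq_add_neg]
  exact add_mem_cell hz (neg_mem_cell hw)

/-- A lattice point with coordinates of modulus less than one is zero. -/
lemma eq_zero_of_mem_lattice_of_mem_cell {z : ℂ} (hz : z ∈ L.lattice) (hz' : z ∈ cell L 1) :
    z = 0 := by
  obtain ⟨m, n, h1, h2⟩ := mem_lattice_iff.1 hz
  rw [mem_cell, h1, h2] at hz'
  have hm : m = 0 := Int.abs_lt_one_iff.1 (by exact_mod_cast hz'.1)
  have hn : n = 0 := Int.abs_lt_one_iff.1 (by exact_mod_cast hz'.2)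
  exact coord_ext (L := L) (by rw [h1, hm]; simp) (by rw [h2, hn]; simp)

variable (L) in
/-- The closed parallelogram `{t ω₁ + s ω₂ : |t| ≤ r, |s| ≤ r}`. -/
def closedCell (r : ℝ) : Set ℂ := {z | |coordOne L z| ≤ r ∧ |coordTwo L z| ≤ r}

lemma isClosed_closedCell (r : ℝ) : IsClosed (closedCell L r) :=
  (isClosed_le (coordOne L).continuous.abs continuous_const).inter
    (isClosed_le (coordTwo L).continuous.abs continuous_const)

lemma isCompact_closedCell (r : ℝ) : IsCompact (closedCell L r) := by
  refine Metric.isCompact_of_isClosed_isBounded (isClosed_closedCell r) ?_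
  rw [isBounded_iff_forall_norm_le]
  refine ⟨r * ‖L.ω₁‖ + r * ‖L.ω₂‖, fun z hz => ?_⟩
  rw [coord_decomp L z]
  refine (norm_add_le _ _).trans ?_
  rw [norm_mul, norm_mul, Complex.norm_real, Complex.norm_real, Real.norm_eq_abs, Real.norm_eq_abs]
  have := hz.1
  have := hz.2
  gcongr

lemma cell_subset_closedCell (r : ℝ) : cell L r ⊆ closedCell L r := fun _ hz =>
  ⟨(mem_cell.1 hz).1.le, (mem_cell.1 hz).2.le⟩

lemma closedCell_subset_cell {r s : ℝ} (h : r < s) : closedCell L r ⊆ cell L s := fun _ hz =>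
  mem_cell.2 ⟨hz.1.trans_lt h, hz.2.trans_lt h⟩

/-- A point `z` of the closed parallelogram is the limit of `t z` as `t` increases to `1`. -/
lemma mem_closure_Omega {z : ℂ} : z ∈ closure (Omega L) ↔ z ∈ closedCell L (1 / 2) := by
  constructor
  · exact fun hz => closure_minimal (cell_subset_closedCell _) (isClosed_closedCell _) hz
  · intro hz
    have ht : Tendsto (fun t : ℝ => t • z) (𝓝[<] 1) (𝓝 z) := by
      have : ContinuousAt (fun t : ℝ => t • z) 1 := by fun_prop
      have h := this.tendsto
      rw [one_smul] at h
      exact h.mono_left nhdsWithin_le_nhds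
    refine mem_closure_of_tendsto ht ?_
    have h01 : Set.Ioo (0 : ℝ) 1 ∈ 𝓝[<] (1 : ℝ) := Ioo_mem_nhdsLT zero_lt_one
    filter_upwards [h01] with t ht
    refine mem_cell.2 ⟨?_, ?_⟩
    · rw [map_smul, smul_eq_mul, abs_mul, abs_of_pos ht.1]
      nlinarith [hz.1, ht.1, ht.2, abs_nonneg (coordOne L z)]
    · rw [map_smul, smul_eq_mul, abs_mul, abs_of_pos ht.1]
      nlinarith [hz.2, ht.1, ht.2, abs_nonneg (coordTwo L z)]

variable (L) in
lemma exists_lattice_sub_mem (z : ℂ) : ∃ l ∈ L.lattice, z - l ∈ closedCell L (1 / 2) := by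
  refine ⟨(round (coordOne L z) : ℝ) * L.ω₁ + (round (coordTwo L z) : ℝ) * L.ω₂,
    mem_lattice_iff.2 ⟨_, _, coordOne_combo L _ _, coordTwo_combo L _ _⟩, ?_, ?_⟩
  · rw [map_sub, coordOne_combo]
    exact abs_sub_round _
  · rw [map_sub, coordTwo_combo]
    exact abs_sub_round _

/-- A lattice-invariant function can be integrated over any translate of the period cell. -/
lemma isAddFundamentalDomain_Omega (a : ℂ) :
    IsAddFundamentalDomain L.lattice {z | z + a ∈ Omega L} (volume : Measure ℂ) := by
  have hcount : Countable L.lattice := inferInstance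
  refine IsAddFundamentalDomain.mk'' ?_ ?_ ?_ ?_
  · exact ((isOpen_cell (L := L) (1 / 2)).preimage (continuous_add_const a)).measurableSet.nullMeasurableSet
  · have hfr : volume (frontier (Omega L)) = 0 := (convex_cell _).addHaar_frontier volume
    have hae : ∀ᵐ z : ℂ, ∀ l : L.lattice, z + (a + l) ∉ frontier (Omega L) := by
      rw [ae_all_iff]
      intro l
      have := (measurePreserving_add_right (volume : Measure ℂ) (a + l)).quasiMeasurePreserving.ae
        (measure_eq_zero_iff_ae_notMem.1 hfr)
      exact this
    filter_upwards [hae] with z hz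
    obtain ⟨l, hl, hzl⟩ := exists_lattice_sub_mem L (z + a)
    refine ⟨⟨-l, neg_mem hl⟩, ?_⟩
    have h1 := hz ⟨-l, neg_mem hl⟩
    have e1 : z + (a + -l) = z + a - l := by ring
    have e2 : -l + z + a = z + a - l := by ring
    change -l + z + a ∈ Omega L
    rw [e2]
    by_contra h
    apply h1
    simp only [e1]
    rw [frontier, IsOpen.interior_eq (s := Omega L) (isOpen_cell _)]
    exact ⟨mem_closure_Omega.2 hzl, h⟩
  · rintro ⟨l, hl⟩ hne
    refine Disjoint.aedisjoint (Set.disjoint_left.2 ?_)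
    rintro z ⟨y, hy, rfl⟩ hz
    apply hne
    have hz' : l + y + a ∈ Omega L := hz
    have hy' : y + a ∈ Omega L := hy
    have h3 := sub_mem_cell hz' hy'
    norm_num at h3
    exact Subtype.ext (eq_zero_of_mem_lattice_of_mem_cell hl h3)
  · intro l
    exact (measurePreserving_add_left (volume : Measure ℂ) (l : ℂ)).quasiMeasurePreserving

lemma setIntegral_translate_Omega (a : ℂ) {f : ℂ → ℝ} (hf : ∀ z, ∀ l ∈ L.lattice, f (z + l) = f z) :
    ∫ z in {z | z + a ∈ Omega L}, f z = ∫ z in Omega L, f z := by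
  have h0 := isAddFundamentalDomain_Omega (L := L) 0
  simp only [add_zero, Set.ofPred_mem_eq] at h0
  have : VAddInvariantMeasure L.lattice ℂ volume :=
    ⟨fun l s _ => measure_preimage_add volume (l : ℂ) s⟩
  refine (isAddFundamentalDomain_Omega a).setIntegral_eq h0 fun l z => ?_
  change f (l + z) = f z
  rw [add_comm]
  exact hf z l l.2

end TorusVortex

end

noncomputable section

namespace TorusVortex

variable {L : PeriodPair}

/-! ### The Green function as the logarithm of a modulus -/

/-- This fixes the factor `1/4`: `κ/4 · |z|²` has Laplacian `κ = 1/|Ω|`, so subtracting it from `H`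
leaves a harmonic function. -/
lemma laplacian_norm_sq (z : ℂ) : Laplacian.laplacian (fun z : ℂ => ‖z‖ ^ 2) z = 4 := by
  rw [InnerProductSpace.laplacian_eq_iteratedFDeriv_complexPlane]
  have h : fderiv ℝ (fun z : ℂ => ‖z‖ ^ 2) = fun z => (2 • innerSL ℝ : ℂ →L[ℝ] ℂ →L[ℝ] ℝ) z := by
    ext z : 1
    rw [fderiv_norm_sq_apply]
    rfl
  simp only [iteratedFDeriv_two_apply, h, ContinuousLinearMap.fderiv]
  have h1 : ((2 • innerSL ℝ : ℂ →L[ℝ] ℂ →L[ℝ] ℝ) 1) 1 = 2 := by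
    change (2 : ℕ) • inner ℝ (1 : ℂ) 1 = 2
    simp
  have h2 : ((2 • innerSL ℝ : ℂ →L[ℝ] ℂ →L[ℝ] ℝ) Complex.I) Complex.I = 2 := by
    change (2 : ℕ) • inner ℝ Complex.I Complex.I = 2
    simp
  refine (congrArg₂ (· + ·) h1 h2).trans ?_
  norm_num

lemma harmonicAt_regular_part {G H : ℂ → ℝ} (hG : IsGreenFunction L G H) {z : ℂ}
    (hz : z ∈ twoOmega L) :
    InnerProductSpace.HarmonicAt (fun z => H z - 1 / volume.real (Omega L) / 4 * ‖z‖ ^ 2) z := by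
  set κ := 1 / volume.real (Omega L) with hκ
  have hopen : IsOpen (twoOmega L) := isOpen_cell 1
  have hHs : ∀ w ∈ twoOmega L, ContDiffAt ℝ 2 H w := fun w hw =>
    ((hG.smooth w hw).contDiffAt (hopen.mem_nhds hw)).of_le (WithTop.coe_le_coe.2 le_top)
  have hqs : ∀ w : ℂ, ContDiffAt ℝ 2 ((κ / 4) • fun z : ℂ => ‖z‖ ^ 2) w := fun w =>
    contDiffAt_const.smul (contDiff_norm_sq ℝ).contDiffAt
  have hfun : (fun z => H z - κ / 4 * ‖z‖ ^ 2) = H - (κ / 4) • fun z : ℂ => ‖z‖ ^ 2 := rfl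
  rw [hfun]
  refine ⟨(hHs z hz).sub (hqs z), ?_⟩
  filter_upwards [hopen.mem_nhds hz] with w hw
  rw [(hHs w hw).laplacian_sub (hqs w), hG.laplacian w hw,
    InnerProductSpace.laplacian_smul _ (contDiff_norm_sq ℝ).contDiffAt, laplacian_norm_sq]
  simp only [Pi.zero_apply, smul_eq_mul]
  ring

lemma exists_analyticAt_re_eq {u : ℂ → ℝ} {z : ℂ} (hu : InnerProductSpace.HarmonicAt u z) :
    ∃ f : ℂ → ℂ, AnalyticAt ℂ f z ∧ ∀ᶠ w in 𝓝 z, u w = (f w).re := by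
  obtain ⟨r, hr, hball⟩ := Metric.eventually_nhds_iff_ball.1 hu.eventually
  obtain ⟨f, hf, hre⟩ :=
    InnerProductSpace.HarmonicOnNhd.exists_analyticOnNhd_ball_re_eq (f := u) (z := z) (R := r) hball
  refine ⟨f, hf z (Metric.mem_ball_self hr), ?_⟩
  filter_upwards [Metric.ball_mem_nhds z hr] with w hw
  exact (hre hw).symm

/-- Near each point, `exp (2π (G(z) - |z|² / (4 |Ω|)))` is the modulus of a non-vanishing
holomorphic function divided by the distance to a lattice point. -/
lemma exists_local_modulus {G H : ℂ → ℝ} (hG : IsGreenFunction L G H) (z₀ : ℂ) :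
    ∃ l ∈ L.lattice, (z₀ ∈ L.lattice → z₀ = l) ∧ ∃ g : ℂ → ℂ, AnalyticAt ℂ g z₀ ∧ g z₀ ≠ 0 ∧
      ∀ᶠ z in 𝓝 z₀, z ≠ l →
        Real.exp (2 * Real.pi * (G z - 1 / volume.real (Omega L) / 4 * ‖z‖ ^ 2)) =
          ‖g z / (z - l)‖ := by
  obtain ⟨l, hl, hzl⟩ := exists_lattice_sub_mem L z₀
  have hzl1 : z₀ - l ∈ twoOmega L := closedCell_subset_cell (by norm_num) hzl
  refine ⟨l, hl, fun hz => ?_, ?_⟩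
  · exact sub_eq_zero.1 (eq_zero_of_mem_lattice_of_mem_cell (L.lattice.sub_mem hz hl) hzl1)
  obtain ⟨f, hf, hfe⟩ := exists_analyticAt_re_eq (harmonicAt_regular_part hG hzl1)
  set κ := 1 / volume.real (Omega L) with hκ
  have hsub : AnalyticAt ℂ (fun z => z - l) z₀ := analyticAt_id.sub analyticAt_const
  have hfc : AnalyticAt ℂ (fun z => f (z - l)) z₀ :=
    AnalyticAt.fun_comp (f := fun z => z - l) hf hsub
  -- Expanding `|z|² = |z - l|² + 2 Re(l̄ (z - l)) + |l|²`, the first term is already contained in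
  -- the harmonic function `Re f`, and the others are the real part of an affine holomorphic
  -- function. The logarithm in `G` produces the division by `z - l`.
  refine ⟨fun z => Complex.exp (2 * Real.pi * (f (z - l) -
    (κ / 4 : ℝ) * (2 * (starRingEnd ℂ l * (z - l)) + (‖l‖ ^ 2 : ℝ)))), ?_, Complex.exp_ne_zero _, ?_⟩
  · exact (analyticAt_const.mul (hfc.sub (analyticAt_const.mul
      ((analyticAt_const.mul (analyticAt_const.mul hsub)).add analyticAt_const)))).cexp
  · have h1 : ∀ᶠ z in 𝓝 z₀, z - l ∈ twoOmega L :=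
      hsub.continuousAt.eventually_mem ((isOpen_cell 1).mem_nhds hzl1)
    have h2 := hsub.continuousAt.eventually hfe
    filter_upwards [h1, h2] with z hz1 hz2 hzl
    have hzl' : z - l ≠ 0 := sub_ne_zero.2 hzl
    have hGz : G z = -(1 / (2 * Real.pi)) * Real.log ‖z - l‖ + H (z - l) := by
      rw [← hG.decomp _ hz1 hzl', ← hG.periodic (z - l) l hl, sub_add_cancel]
    have hnorm : ‖z‖ ^ 2 = ‖z - l‖ ^ 2 + 2 * (starRingEnd ℂ l * (z - l)).re + ‖l‖ ^ 2 := by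
      simp only [← Complex.normSq_eq_norm_sq, Complex.normSq_apply, Complex.mul_re,
        Complex.conj_re, Complex.conj_im, Complex.sub_re, Complex.sub_im]
      ring
    rw [norm_div, Complex.norm_exp]
    have hre : (2 * Real.pi * (f (z - l) - (κ / 4 : ℝ) * (2 * (starRingEnd ℂ l * (z - l)) +
        (‖l‖ ^ 2 : ℝ))) : ℂ).re = 2 * Real.pi * ((f (z - l)).re - κ / 4 *
          (2 * (starRingEnd ℂ l * (z - l)).re + ‖l‖ ^ 2)) := by
      rw [show (2 * Real.pi : ℂ) = ((2 * Real.pi : ℝ) : ℂ) by push_cast; rfl, Complex.re_ofReal_mul,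
        Complex.sub_re, Complex.re_ofReal_mul, Complex.add_re, Complex.ofReal_re]
      congr 4
      simp
    rw [hre, ← hz2, hGz, hnorm]
    have hpos : 0 < ‖z - l‖ := norm_pos_iff.2 hzl'
    have hpi := Real.pi_ne_zero
    rw [eq_div_iff hpos.ne', ← eq_div_iff hpos.ne']
    conv_rhs => rw [← Real.exp_log hpos, ← Real.exp_sub]
    rw [Real.exp_log hpos]
    congr 1
    field_simp
    ring

lemma continuousAt_green {G H : ℂ → ℝ} (hG : IsGreenFunction L G H) {z₀ : ℂ}
    (hz : z₀ ∉ L.lattice) : ContinuousAt G z₀ := by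
  obtain ⟨l, hl, hzl⟩ := exists_lattice_sub_mem L z₀
  have hzl1 : z₀ - l ∈ twoOmega L := closedCell_subset_cell (by norm_num) hzl
  have hne : z₀ - l ≠ 0 := fun h => hz (by rwa [sub_eq_zero.1 h])
  have hopen : IsOpen (twoOmega L) := isOpen_cell 1
  have hsub : ContinuousAt (fun z => z - l) z₀ := by fun_prop
  have hH : ContinuousAt H (z₀ - l) := hG.smooth.continuousOn.continuousAt (hopen.mem_nhds hzl1)
  have hH' : ContinuousAt (fun z => H (z - l)) z₀ :=
    ContinuousAt.comp (f := fun z => z - l) hH hsub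
  have : ContinuousAt (fun z => -(1 / (2 * Real.pi)) * Real.log ‖z - l‖ + H (z - l)) z₀ :=
    (continuousAt_const.mul (hsub.norm.log (norm_ne_zero_iff.2 hne))).add hH'
  refine this.congr ?_
  filter_upwards [hsub.eventually_mem (hopen.mem_nhds hzl1), hsub.eventually_ne hne] with z h1 h2
  rw [← hG.decomp _ h1 h2, ← hG.periodic (z - l) l hl, sub_add_cancel]

/-! ### The maximum principle on the torus -/

/-- A lattice-periodic function that is, up to removable singularities, locally the modulus of a
holomorphic function is constant. -/
lemma exists_const_of_local_modulus {u : ℂ → ℝ} (hper : ∀ z, ∀ l ∈ L.lattice, u (z + l) = u z)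
    (hloc : ∀ z₀, ∃ f : ℂ → ℂ, AnalyticAt ℂ f z₀ ∧ ∀ᶠ z in 𝓝[≠] z₀, u z = ‖f z‖) :
    ∃ c, ∀ z₀, ∀ᶠ z in 𝓝[≠] z₀, u z = c := by
  choose f hf hfu using hloc
  -- `v` is `u` with its removable singularities filled in; the uniqueness of punctured limits makes
  -- it continuous, periodic and locally equal to each `‖f z₀‖`.
  set v : ℂ → ℝ := fun z => ‖f z z‖ with hv
  have htend : ∀ z₀, Tendsto u (𝓝[≠] z₀) (𝓝 (v z₀)) := fun z₀ =>
    ((hf z₀).continuousAt.norm.tendsto.mono_left nhdsWithin_le_nhds).congr'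
      ((hfu z₀).mono fun z hz => hz.symm)
  have hvf : ∀ z₀, ∀ᶠ z in 𝓝 z₀, v z = ‖f z₀ z‖ := by
    intro z₀
    have h1 := eventually_eventually_nhds.2 (eventually_nhdsWithin_iff.1 (hfu z₀))
    filter_upwards [h1, (hf z₀).eventually_analyticAt] with z hz hza
    by_cases hzz : z = z₀
    · rw [hzz]
    · refine tendsto_nhds_unique (htend z)
        ((hza.continuousAt.norm.tendsto.mono_left nhdsWithin_le_nhds).congr' ?_)
      filter_upwards [nhdsWithin_le_nhds hz, nhdsWithin_le_nhds (isOpen_ne.mem_nhds hzz)] with w h2 h3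
      exact (h2 h3).symm
  have hvc : Continuous v := continuous_iff_continuousAt.2 fun z₀ =>
    (hf z₀).continuousAt.norm.congr ((hvf z₀).mono fun z hz => hz.symm)
  have hvper : ∀ z, ∀ l ∈ L.lattice, v (z + l) = v z := by
    intro z l hl
    refine tendsto_nhds_unique (f := fun w => u (w + l)) (l := 𝓝[≠] z) ?_ ?_
    · refine (htend (z + l)).comp ?_
      refine tendsto_nhdsWithin_iff.2 ⟨?_, ?_⟩
      · exact ((continuous_add_const l).tendsto z).mono_left nhdsWithin_le_nhds
      · filter_upwards [self_mem_nhdsWithin] with w hw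
        simpa using hw
    · simp_rw [fun w => hper w l hl]
      exact htend z
  obtain ⟨z₁, -, hz₁⟩ := (isCompact_closedCell (L := L) (1 / 2)).exists_isMaxOn
    ⟨0, by simp [closedCell]⟩ hvc.continuousOn
  have hmax : ∀ z, v z ≤ v z₁ := by
    intro z
    obtain ⟨l, hl, hzl⟩ := exists_lattice_sub_mem L z
    have := hvper (z - l) l hl
    rw [sub_add_cancel] at this
    rw [this]
    exact hz₁ hzl
  -- The maximum exists by compactness of the closed cell. The set where it is attained is closed by
  -- continuity and open by the maximum modulus principle.
  have hclopen : IsClopen {z | v z = v z₁} := by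
    refine ⟨isClosed_eq hvc continuous_const, isOpen_iff_mem_nhds.2 fun z hz => ?_⟩
    have hz' : v z = v z₁ := hz
    have hloc : IsLocalMax (norm ∘ f z) z := by
      filter_upwards [hvf z] with w hw
      change ‖f z w‖ ≤ ‖f z z‖
      rw [← hw]
      change v w ≤ v z
      rw [hz']
      exact hmax w
    have hd : ∀ᶠ w in 𝓝 z, DifferentiableAt ℂ (f z) w :=
      (hf z).eventually_analyticAt.mono fun w hw => hw.differentiableAt
    filter_upwards [Complex.eventually_eq_of_isLocalMax_norm hd hloc, hvf z] with w h1 h2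
    exact (h2.trans (congrArg norm h1)).trans hz'
  have huniv := hclopen.eq_univ ⟨z₁, rfl⟩
  refine ⟨v z₁, fun z₀ => ?_⟩
  filter_upwards [hfu z₀, nhdsWithin_le_nhds (hvf z₀)] with z h1 h2
  rw [h1, ← h2]
  exact (Set.eq_univ_iff_forall.1 huniv z : _)

end TorusVortex

end

noncomputable section

namespace TorusVortex

variable {L : PeriodPair}

/-! ### Differences of Weierstrass functions -/

lemma weierstrassP_add_lattice (z : ℂ) {l : ℂ} (hl : l ∈ L.lattice) :
    L.weierstrassP (z + l) = L.weierstrassP z := L.weierstrassP_add_coe z ⟨l, hl⟩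

lemma analyticAt_weierstrassP {z : ℂ} (hz : z ∉ L.lattice) : AnalyticAt ℂ L.weierstrassP z :=
  L.analyticOnNhd_weierstrassP z hz

lemma weierstrassP_eq_of_sub_mem {z k : ℂ} (h : z - k ∈ L.lattice) :
    L.weierstrassP z = L.weierstrassP k := by
  rw [← weierstrassP_add_lattice k h]
  congr 1
  ring

lemma weierstrassP_eq_of_add_mem {z k : ℂ} (h : z + k ∈ L.lattice) :
    L.weierstrassP z = L.weierstrassP k := by
  rw [← L.weierstrassP_neg k]
  exact weierstrassP_eq_of_sub_mem (by simpa using h)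

/-- The derivative of `℘` vanishes at half-periods. -/
lemma deriv_weierstrassP_eq_zero {z : ℂ} (h : 2 * z ∈ L.lattice) : deriv L.weierstrassP z = 0 := by
  rw [L.deriv_weierstrassP]
  have h1 := L.derivWeierstrassP_neg z
  have h2 := L.derivWeierstrassP_add_coe (-z) ⟨2 * z, h⟩
  simp only at h2
  rw [show -z + 2 * z = z by ring, h1] at h2
  have h3 : (2 : ℂ) * L.derivWeierstrassP z = 0 := by linear_combination h2
  simpa using h3

lemma exists_analyticAt_sub_eq_mul {f : ℂ → ℂ} {a : ℂ} (hf : AnalyticAt ℂ f a) :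
    ∃ g : ℂ → ℂ, AnalyticAt ℂ g a ∧ g a = deriv f a ∧ ∀ z, f z - f a = (z - a) * g z := by
  refine ⟨dslope f a, ?_, dslope_same f a, fun z => by
    simpa using (sub_smul_dslope f a z).symm⟩
  obtain ⟨s, hs, hd⟩ := hf.exists_mem_nhds_analyticOnNhd
  exact ((Complex.differentiableOn_dslope hs).2 hd.differentiableOn).analyticAt hs

/-- The zeros of `℘ - ℘(k)` compensate the zeros of `(z - k - l₁) (z + k - l₂)`, and its pole is
compensated by `(z - l₀)²`. -/
lemma exists_analyticAt_weierstrassP_quotient {k : ℂ} (hk : k ∉ L.lattice) {z₀ l₀ l₁ l₂ : ℂ}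
    (h0 : z₀ ∈ L.lattice → z₀ = l₀) (hl₁ : l₁ ∈ L.lattice) (h1 : z₀ - k ∈ L.lattice → z₀ - k = l₁)
    (hl₂ : l₂ ∈ L.lattice) (h2 : z₀ + k ∈ L.lattice → z₀ + k = l₂) :
    ∃ p : ℂ → ℂ, AnalyticAt ℂ p z₀ ∧ ∀ᶠ z in 𝓝[≠] z₀,
      (L.weierstrassP z - L.weierstrassP k) * (z - l₀) ^ 2 / ((z - k - l₁) * (z + k - l₂)) = p z := by
  have hid : ∀ a : ℂ, AnalyticAt ℂ (fun z : ℂ => z - a) z₀ := fun a =>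
    analyticAt_id.sub analyticAt_const
  have e1 : AnalyticAt ℂ (fun z => z - k - l₁) z₀ := (hid k).sub analyticAt_const
  have e2 : AnalyticAt ℂ (fun z => z + k - l₂) z₀ :=
    (analyticAt_id.add analyticAt_const).sub analyticAt_const
  have n1 : z₀ - k ∉ L.lattice → z₀ - k - l₁ ≠ 0 := fun h h' => h (by rwa [sub_eq_zero.1 h'])
  have n2 : z₀ + k ∉ L.lattice → z₀ + k - l₂ ≠ 0 := fun h h' => h (by rwa [sub_eq_zero.1 h'])
  have hne : ∀ᶠ z in 𝓝[≠] z₀, z - z₀ ≠ 0 := by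
    filter_upwards [self_mem_nhdsWithin] with z hz using sub_ne_zero.2 hz
  by_cases hz : z₀ ∈ L.lattice
  · obtain rfl := h0 hz
    have m1 : z₀ - k ∉ L.lattice := fun h => hk (by simpa using L.lattice.sub_mem hz h)
    have m2 : z₀ + k ∉ L.lattice := fun h => hk (by simpa using L.lattice.sub_mem h hz)
    have hex : AnalyticAt ℂ (L.weierstrassPExcept z₀) z₀ := L.analyticAt_weierstrassPExcept z₀
    -- Here `℘` is split into its term at `z₀` and the rest. For `z₀ = 0` the expression `1 / z₀ ^
    -- 2` is `0` by convention, as the series of `℘` requires, so all lattice points are treated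
    -- alike.
    refine ⟨fun z => ((L.weierstrassPExcept z₀ z - 1 / z₀ ^ 2 - L.weierstrassP k) * (z - z₀) ^ 2 + 1) /
      ((z - k - l₁) * (z + k - l₂)), ?_, ?_⟩
    · exact ((((hex.sub analyticAt_const).sub analyticAt_const).mul ((hid z₀).pow 2)).add
        analyticAt_const).div (e1.mul e2) (mul_ne_zero (n1 m1) (n2 m2))
    · filter_upwards [hne] with z hz'
      have := L.weierstrassPExcept_add ⟨z₀, hz⟩ z
      simp only at this
      rw [← this]
      congr 1
      field_simp
      ring
  have hP := analyticAt_weierstrassP hz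
  have hPk : AnalyticAt ℂ (fun z => L.weierstrassP z - L.weierstrassP k) z₀ := hP.sub analyticAt_const
  by_cases m1 : z₀ - k ∈ L.lattice
  · obtain ⟨g, hg, hg0, hgz⟩ := exists_analyticAt_sub_eq_mul hP
    rw [weierstrassP_eq_of_sub_mem m1] at hgz
    have hl₁' : ∀ z : ℂ, z - k - l₁ = z - z₀ := fun z => by rw [← h1 m1]; ring
    -- If both factors of the denominator vanish at `z₀`, then `2 z₀` is a period, `℘'` vanishes
    -- there, and the numerator has a zero of order at least two.
    by_cases m2 : z₀ + k ∈ L.lattice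
    · have hl₂' : ∀ z : ℂ, z + k - l₂ = z - z₀ := fun z => by rw [← h2 m2]; ring
      obtain ⟨q, hq, -, hqz⟩ := exists_analyticAt_sub_eq_mul hg
      have h2z : 2 * z₀ ∈ L.lattice := by
        convert L.lattice.add_mem m1 m2 using 1
        ring
      rw [hg0, deriv_weierstrassP_eq_zero h2z] at hqz
      refine ⟨fun z => q z * (z - l₀) ^ 2, hq.mul ((hid l₀).pow 2), ?_⟩
      filter_upwards [hne] with z hz'
      rw [hgz z, hl₁', hl₂', show g z = (z - z₀) * q z by simpa using hqz z]
      field_simp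
    · refine ⟨fun z => g z * (z - l₀) ^ 2 / (z + k - l₂),
        (hg.mul ((hid l₀).pow 2)).div e2 (n2 m2), ?_⟩
      filter_upwards [hne] with z hz'
      rw [hgz z, hl₁', mul_assoc, mul_div_mul_left _ _ hz']
  · by_cases m2 : z₀ + k ∈ L.lattice
    · obtain ⟨g, hg, hg0, hgz⟩ := exists_analyticAt_sub_eq_mul hP
      rw [weierstrassP_eq_of_add_mem m2] at hgz
      have hl₂' : ∀ z : ℂ, z + k - l₂ = z - z₀ := fun z => by rw [← h2 m2]; ring
      refine ⟨fun z => g z * (z - l₀) ^ 2 / (z - k - l₁),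
        (hg.mul ((hid l₀).pow 2)).div e1 (n1 m1), ?_⟩
      filter_upwards [hne] with z hz'
      rw [hgz z, hl₂', mul_assoc, mul_comm (z - k - l₁), mul_div_mul_left _ _ hz']
    · exact ⟨_, (hPk.mul ((hid l₀).pow 2)).div (e1.mul e2) (mul_ne_zero (n1 m1) (n2 m2)),
        Eventually.of_forall fun z => rfl⟩

/-- Near the origin, `|z|² |℘(z) - c|` tends to one. -/
lemma tendsto_sq_mul_weierstrassP_sub (c : ℂ) :
    Tendsto (fun z => z ^ 2 * (L.weierstrassP z - c)) (𝓝[≠] 0) (𝓝 1) := by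
  have hex : ContinuousAt (L.weierstrassPExcept 0) 0 := (L.analyticAt_weierstrassPExcept 0).continuousAt
  have h : ContinuousAt (fun z => z ^ 2 * (L.weierstrassPExcept 0 z - c) + 1) 0 := by fun_prop
  have ht : Tendsto (fun z => z ^ 2 * (L.weierstrassPExcept 0 z - c) + 1) (𝓝[≠] 0) (𝓝 1) := by
    have := h.tendsto.mono_left (nhdsWithin_le_nhds (s := {(0 : ℂ)}ᶜ))
    simpa using this
  refine ht.congr' ?_
  filter_upwards [self_mem_nhdsWithin] with z hz
  have hz' : z ≠ 0 := hz
  have := L.weierstrassPExcept_add 0 z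
  simp only [ZeroMemClass.coe_zero, sub_zero] at this
  rw [← this]
  field_simp
  simp
  ring

/-- The modulus of `℘(z) - ℘(k)` in terms of the Green function. -/
theorem norm_weierstrassP_sub {G H : ℂ → ℝ} (hG : IsGreenFunction L G H) {k z : ℂ}
    (hk : k ∉ L.lattice) (hz : z ∉ L.lattice) (hzk : z - k ∉ L.lattice) (hzk' : z + k ∉ L.lattice) :
    ‖L.weierstrassP z - L.weierstrassP k‖ =
      Real.exp (2 * Real.pi * (2 * G z - G (z - k) - G (z + k)) + 2 * Real.pi * (G k + G (-k)) -
        4 * Real.pi * H 0) := by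
  set κ := 1 / volume.real (Omega L) with hκ
  set u : ℂ → ℝ := fun z => ‖L.weierstrassP z - L.weierstrassP k‖ *
    Real.exp (-(2 * Real.pi * (2 * G z - G (z - k) - G (z + k)))) with hu
  have hper : ∀ z, ∀ l ∈ L.lattice, u (z + l) = u z := by
    intro z l hl
    simp only [hu]
    rw [weierstrassP_add_lattice z hl, hG.periodic z l hl,
      show z + l - k = z - k + l by ring, hG.periodic _ l hl,
      show z + l + k = z + k + l by ring, hG.periodic _ l hl]
  have hloc : ∀ z₀, ∃ f : ℂ → ℂ, AnalyticAt ℂ f z₀ ∧ ∀ᶠ z in 𝓝[≠] z₀, u z = ‖f z‖ := by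
    intro z₀
    obtain ⟨l₀, hl₀, h0, g₀, hg₀, hg₀', he₀⟩ := exists_local_modulus hG z₀
    obtain ⟨l₁, hl₁, h1, g₁, hg₁, -, he₁⟩ := exists_local_modulus hG (z₀ - k)
    obtain ⟨l₂, hl₂, h2, g₂, hg₂, -, he₂⟩ := exists_local_modulus hG (z₀ + k)
    obtain ⟨p, hp, hpe⟩ := exists_analyticAt_weierstrassP_quotient hk h0 hl₁ h1 hl₂ h2
    have a1 : AnalyticAt ℂ (fun z => z - k) z₀ := analyticAt_id.sub analyticAt_const
    have a2 : AnalyticAt ℂ (fun z => z + k) z₀ := analyticAt_id.add analyticAt_const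
    have b1 : AnalyticAt ℂ (fun z => g₁ (z - k)) z₀ := AnalyticAt.fun_comp (f := fun z => z - k) hg₁ a1
    have b2 : AnalyticAt ℂ (fun z => g₂ (z + k)) z₀ := AnalyticAt.fun_comp (f := fun z => z + k) hg₂ a2
    have c1 := a1.continuousAt.eventually he₁
    have c2 := a2.continuousAt.eventually he₂
    have hne : ∀ a : ℂ, ∀ᶠ z in 𝓝[≠] z₀, z ≠ a := by
      intro a
      by_cases ha : z₀ = a
      · rw [← ha]
        exact self_mem_nhdsWithin
      · exact nhdsWithin_le_nhds (isOpen_ne.mem_nhds ha)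
    -- The three quadratic corrections combine to this constant by the parallelogram law.
    set C : ℝ := Real.exp (4 * Real.pi * (κ / 4 * ‖k‖ ^ 2)) with hC
    refine ⟨fun z => (C : ℂ) * (p z * (g₁ (z - k) * g₂ (z + k)) / g₀ z ^ 2), ?_, ?_⟩
    · exact analyticAt_const.mul ((hp.mul (b1.mul b2)).div (hg₀.pow 2) (pow_ne_zero 2 hg₀'))
    filter_upwards [hpe, nhdsWithin_le_nhds he₀, nhdsWithin_le_nhds c1, nhdsWithin_le_nhds c2,
      hne l₀, hne (k + l₁), hne (l₂ - k),
      nhdsWithin_le_nhds (hg₀.continuousAt.eventually_ne hg₀')] with z e0 e1 e2 e3 m0 m1 m2 m3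
    have e1' := e1 m0
    have e2' := e2 (fun h => m1 (by rw [← h]; ring))
    have e3' := e3 (fun h => m2 (by rw [← h]; ring))
    have m0' : z - l₀ ≠ 0 := sub_ne_zero.2 m0
    have hpar : ‖z - k‖ ^ 2 + ‖z + k‖ ^ 2 = 2 * ‖z‖ ^ 2 + 2 * ‖k‖ ^ 2 := by
      have := parallelogram_law_with_norm ℝ z k
      linarith [this]
    have hexp : Real.exp (-(2 * Real.pi * (2 * G z - G (z - k) - G (z + k)))) =
        C * (Real.exp (2 * Real.pi * (G (z - k) - κ / 4 * ‖z - k‖ ^ 2)) *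
          Real.exp (2 * Real.pi * (G (z + k) - κ / 4 * ‖z + k‖ ^ 2)) /
          Real.exp (2 * Real.pi * (G z - κ / 4 * ‖z‖ ^ 2)) ^ 2) := by
      rw [hC, ← Real.exp_nat_mul, ← Real.exp_add, ← Real.exp_sub, ← Real.exp_add]
      congr 1
      push_cast
      linear_combination (Real.pi * κ / 2) * hpar
    have hCn : ‖(C : ℂ)‖ = C := by
      rw [Complex.norm_real, Real.norm_eq_abs, abs_of_pos (Real.exp_pos _)]
    change ‖L.weierstrassP z - L.weierstrassP k‖ * _ = _
    rw [hexp, e1', e2', e3', ← e0, ← norm_mul, ← norm_pow, ← norm_div]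
    nth_rewrite 1 [← hCn]
    rw [← norm_mul, ← norm_mul]
    congr 1
    field_simp
  obtain ⟨c, hc⟩ := exists_const_of_local_modulus hper hloc
  -- The constant is read off as `z → 0`, where `z² (℘(z) - ℘(k)) → 1` and `|z|²` is exactly the
  -- logarithmic part of `2 G(z)`.
  have hc0 : c = Real.exp (2 * Real.pi * (G k + G (-k)) - 4 * Real.pi * H 0) := by
    have t1 : Tendsto u (𝓝[≠] 0) (𝓝 c) := tendsto_const_nhds.congr' ((hc 0).mono fun z hz => hz.symm)
    have hk' : -k ∉ L.lattice := fun h => hk (by simpa using L.lattice.neg_mem h)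
    have cG1 : ContinuousAt (fun z => G (z - k)) 0 :=
      ContinuousAt.comp (f := fun z => z - k) (by simpa using continuousAt_green hG hk') (by fun_prop)
    have cG2 : ContinuousAt (fun z => G (z + k)) 0 :=
      ContinuousAt.comp (f := fun z => z + k) (by simpa using continuousAt_green hG hk) (by fun_prop)
    have cH : ContinuousAt H 0 := hG.smooth.continuousOn.continuousAt (cell_mem_nhds one_pos)
    have t2 : Tendsto (fun z => Real.exp (2 * Real.pi * (G (z - k) + G (z + k)) - 4 * Real.pi * H z))
        (𝓝[≠] 0) (𝓝 (Real.exp (2 * Real.pi * (G (0 - k) + G (0 + k)) - 4 * Real.pi * H 0))) := by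
      have : ContinuousAt
          (fun z => Real.exp (2 * Real.pi * (G (z - k) + G (z + k)) - 4 * Real.pi * H z)) 0 :=
        ((continuousAt_const.mul (cG1.add cG2)).sub (continuousAt_const.mul cH)).rexp
      exact this.tendsto.mono_left nhdsWithin_le_nhds
    have t3 := (tendsto_sq_mul_weierstrassP_sub (L := L) (L.weierstrassP k)).norm.mul t2
    have t4 : Tendsto u (𝓝[≠] 0)
        (𝓝 (‖(1 : ℂ)‖ * Real.exp (2 * Real.pi * (G (0 - k) + G (0 + k)) - 4 * Real.pi * H 0))) := by
      refine t3.congr' ?_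
      filter_upwards [self_mem_nhdsWithin, nhdsWithin_le_nhds (cell_mem_nhds (L := L) one_pos)]
        with w hw hw1
      have hw' : w ≠ 0 := hw
      have hpos : 0 < ‖w‖ := norm_pos_iff.2 hw'
      have hsq : ‖w‖ ^ 2 = Real.exp (2 * Real.log ‖w‖) := by
        rw [mul_comm, Real.exp_mul, Real.exp_log hpos]
        norm_num
      simp only [hu]
      rw [norm_mul, norm_pow, hsq, mul_comm (Real.exp (2 * Real.log ‖w‖)), mul_assoc, ← Real.exp_add,
        hG.decomp w hw1 hw']
      congr 2
      have := Real.pi_ne_zero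
      field_simp
      ring
    rw [tendsto_nhds_unique t1 t4]
    simp only [norm_one, one_mul, zero_sub, zero_add]
    rw [add_comm (G (-k))]
  -- The maximum principle gives equality only in punctured neighbourhoods; continuity of `u` off
  -- the singular points transfers it to `z`.
  have huz : u z = c := by
    have hcont : ContinuousAt u z := by
      have cP := (analyticAt_weierstrassP hz).continuousAt
      have cG1 : ContinuousAt (fun z => G (z - k)) z :=
        ContinuousAt.comp (f := fun z => z - k) (continuousAt_green hG hzk) (by fun_prop)
      have cG2 : ContinuousAt (fun z => G (z + k)) z :=
        ContinuousAt.comp (f := fun z => z + k) (continuousAt_green hG hzk') (by fun_prop)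
      exact (cP.sub continuousAt_const).norm.mul (continuousAt_const.mul
        (((continuousAt_const.mul (continuousAt_green hG hz)).sub cG1).sub cG2)).neg.rexp
    exact tendsto_nhds_unique (hcont.tendsto.mono_left nhdsWithin_le_nhds)
      (tendsto_const_nhds.congr' ((hc z).mono fun z hz => hz.symm))
  rw [hc0] at huz
  simp only [hu] at huz
  rw [Real.exp_neg, ← div_eq_mul_inv, div_eq_iff (Real.exp_ne_zero _), ← Real.exp_add] at huz
  rw [huz]
  congr 1
  ring

end TorusVortex

end

noncomputable section

namespace TorusVortex

variable {L : PeriodPair}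

/-! ### Even configurations -/

lemma notMem_lattice_of_mem_representatives {V J : Finset ℂ} {m : ℂ → ℕ}
    (hper : IsPeriodicConfiguration L V m) (hJ : IsRepresentatives L V J) {j : ℂ} (hj : j ∈ J) :
    j ∉ L.lattice := fun h => hJ.ne_zero <| by
  have h1 := mem_closure_Omega.1 (hper.mem_closure j (hJ.subset hj))
  rwa [eq_zero_of_mem_lattice_of_mem_cell h (closedCell_subset_cell (by norm_num) h1)] at hj

/-- Each representative has a partner congruent to its negative. -/
lemma exists_partner {V J : Finset ℂ} {m : ℂ → ℕ}
    (hper : IsPeriodicConfiguration L V m) (heven : IsEvenConfiguration L V m)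
    (hJ : IsRepresentatives L V J) {j : ℂ} (hj : j ∈ J) :
    ∃ j' ∈ J, j + j' ∈ L.lattice ∧ m j' = m j := by
  obtain ⟨q, hq, hjq, hm⟩ := heven j (hJ.subset hj)
  have hq0 : q ≠ 0 := by
    rintro rfl
    rw [sub_zero] at hjq
    exact notMem_lattice_of_mem_representatives hper hJ hj (by simpa using L.lattice.neg_mem hjq)
  obtain ⟨j', hj', hqj⟩ := hJ.cover q hq hq0
  refine ⟨j', hj', ?_, ?_⟩
  · convert L.lattice.neg_mem (L.lattice.add_mem hjq hqj) using 1
    ring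
  · rw [← hm]
    exact (hper.periodic q hq j' (hper.mem_closure j' (hJ.subset hj'))
      (by simpa using L.lattice.neg_mem hqj)).2

lemma abs_half_int_cases {t : ℝ} {a : ℤ} (h : 2 * t = a) (ht : |t| ≤ 1 / 2) :
    t = -(1 / 2) ∨ t = 0 ∨ t = 1 / 2 := by
  rw [abs_le] at ht
  have h1 : (-2 : ℝ) < a := by linarith
  have h2 : (a : ℝ) < 2 := by linarith
  have h1' : -2 < a := by exact_mod_cast h1
  have h2' : a < 2 := by exact_mod_cast h2
  have : a = -1 ∨ a = 0 ∨ a = 1 := by omega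
  rcases this with rfl | rfl | rfl
  · left; push_cast at h; linarith
  · right; left; push_cast at h; linarith
  · right; right; push_cast at h; linarith

/-- Evenness of multiplicities is assumed at three half-periods only, whereas a point of the closed
cell may have coordinates `-1/2`. Replacing both coordinates by their absolute values is a shift by
a lattice vector. -/
lemma exists_standard_half_period {k : ℂ} (hk : k ∈ closure (Omega L)) (h : IsHalfPeriod L k) :
    ∃ p ∈ closure (Omega L), p - k ∈ L.lattice ∧
      (p = L.ω₁ / 2 ∨ p = L.ω₂ / 2 ∨ p = (L.ω₁ + L.ω₂) / 2) := by
  obtain ⟨a, b, h1, h2⟩ := mem_lattice_iff.1 h.2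
  have hs : (2 : ℂ) * k = (2 : ℝ) • k := by simp
  rw [hs, map_smul, smul_eq_mul] at h1 h2
  rw [mem_closure_Omega] at hk
  have key : ∀ t : ℝ, (t = -(1 / 2) ∨ t = 0 ∨ t = 1 / 2) → ∃ c : ℤ, |t| - t = c := by
    rintro t (rfl | rfl | rfl)
    · exact ⟨1, by norm_num [abs_of_pos]⟩
    · exact ⟨0, by simp⟩
    · exact ⟨0, by norm_num [abs_of_pos]⟩
  have c1 := abs_half_int_cases h1 hk.1
  have c2 := abs_half_int_cases h2 hk.2
  obtain ⟨a', ha'⟩ := key _ c1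
  obtain ⟨b', hb'⟩ := key _ c2
  refine ⟨(|coordOne L k| : ℝ) * L.ω₁ + (|coordTwo L k| : ℝ) * L.ω₂, ?_, ?_, ?_⟩
  · rw [mem_closure_Omega]
    refine ⟨?_, ?_⟩
    · rw [coordOne_combo, abs_abs]
      exact hk.1
    · rw [coordTwo_combo, abs_abs]
      exact hk.2
  · refine mem_lattice_iff.2 ⟨a', b', ?_, ?_⟩
    · rw [map_sub, coordOne_combo, ha']
    · rw [map_sub, coordTwo_combo, hb']
  · have d1 : |coordOne L k| = 0 ∨ |coordOne L k| = 1 / 2 := by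
      rcases c1 with h | h | h <;> rw [h] <;> norm_num [abs_of_pos]
    have d2 : |coordTwo L k| = 0 ∨ |coordTwo L k| = 1 / 2 := by
      rcases c2 with h | h | h <;> rw [h] <;> norm_num [abs_of_pos]
    rcases d1 with d1 | d1 <;> rcases d2 with d2 | d2 <;> rw [d1, d2]
    · refine absurd ?_ h.1
      rw [abs_eq_zero] at d1 d2
      exact mem_lattice_iff.2 ⟨0, 0, by simpa using d1, by simpa using d2⟩
    · right; left; push_cast; ring
    · left; push_cast; ring
    · right; right; push_cast; ring

/-- Summation over half representatives. -/
lemma sum_half_representatives {V J I : Finset ℂ} {m : ℂ → ℕ}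
    (hper : IsPeriodicConfiguration L V m) (heven : IsEvenConfiguration L V m)
    (hhalf : ∀ p ∈ V, p = L.ω₁ / 2 ∨ p = L.ω₂ / 2 ∨ p = (L.ω₁ + L.ω₂) / 2 → Even (m p))
    (hJ : IsRepresentatives L V J) (hI : IsHalfRepresentatives L J I) {φ : ℂ → ℝ}
    (hφ : ∀ z, ∀ l ∈ L.lattice, φ (z + l) = φ z) :
    ∑ k ∈ I, (reducedMult L m k : ℝ) * (φ k + φ (-k)) = ∑ j ∈ J, (m j : ℝ) * φ j := by
  classical
  have hpart := fun j (hj : j ∈ J) => exists_partner hper heven hJ hj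
  -- `ι` is the involution of `J` sending `j` to the representative of `-j`. Its fixed points are
  -- the half-periods, and the aim is that `I` meets each orbit exactly once.
  choose! ι hιJ hιs hιm using hpart
  have hIJ : I ⊆ J := hI.1.1
  have huniq : ∀ j ∈ J, ∀ k ∈ J, j + k ∈ L.lattice → k = ι j := fun j hj k hk h =>
    hJ.distinct k hk _ (hιJ j hj) (by simpa using L.lattice.sub_mem h (hιs j hj))
  have hinv : ∀ j ∈ J, ι (ι j) = j := fun j hj =>
    (huniq _ (hιJ j hj) j hj (by rw [add_comm]; exact hιs j hj)).symm
  have hhp : ∀ j ∈ J, (IsHalfPeriod L j ↔ ι j = j) := by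
    refine fun j hj => ⟨fun h => (huniq j hj j hj (by rw [← two_mul]; exact h.2)).symm, fun h => ?_⟩
    refine ⟨notMem_lattice_of_mem_representatives hper hJ hj, ?_⟩
    have := hιs j hj
    rwa [h, ← two_mul] at this
  -- If `k` and a distinct `ι k` both lay in `I`, then `ι k` could be erased, since `k` covers the
  -- same points; this contradicts minimality.
  have hmin : ∀ k ∈ I, ι k ∈ I → ι k = k := by
    intro k hk hιk
    by_contra hne
    have := hI.2 (y := I.erase (ι k)) ⟨(Finset.erase_subset _ _).trans hIJ, fun j hj => ?_⟩
      (Finset.erase_subset _ _) hιk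
    · exact absurd this (Finset.notMem_erase _ _)
    · obtain ⟨k₀, hk₀, h⟩ := hI.1.2 j hj
      by_cases hkk : k₀ = ι k
      · refine ⟨k, Finset.mem_erase.2 ⟨fun h => hne h.symm, hk⟩, ?_⟩
        have hs := hιs k (hIJ hk)
        rcases h with h | h
        · right
          convert L.lattice.add_mem h hs using 1
          rw [hkk]
          ring
        · left
          convert L.lattice.sub_mem h hs using 1
          rw [hkk]
          ring
      · exact ⟨k₀, Finset.mem_erase.2 ⟨hkk, hk₀⟩, h⟩
  have hcov : ∀ j ∈ J, j ∉ I → ι j ∈ I := by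
    intro j hj hjI
    obtain ⟨k, hk, h | h⟩ := hI.1.2 j hj
    · exact absurd (hJ.distinct j hj k (hIJ hk) h ▸ hk) hjI
    · rwa [← huniq j hj k (hIJ hk) h]
  have hφι : ∀ j ∈ J, φ (-j) = φ (ι j) := by
    intro j hj
    rw [← hφ (-j) _ (hιs j hj)]
    congr 1
    ring
  have hterm : ∀ k ∈ I, (reducedMult L m k : ℝ) * (φ k + φ (-k)) =
      m k * φ k + if ι k ≠ k then (m k : ℝ) * φ (-k) else 0 := by
    intro k hk
    have hkJ := hIJ hk
    by_cases h : ι k = k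
    · have hhk := (hhp k hkJ).2 h
      obtain ⟨p, hp, hpk, hpc⟩ :=
        exists_standard_half_period (hper.mem_closure k (hJ.subset hkJ)) hhk
      obtain ⟨hpV, hpm⟩ := hper.periodic k (hJ.subset hkJ) p hp hpk
      have he : Even (m k) := hpm ▸ hhalf p hpV hpc
      obtain ⟨r, hr⟩ := he
      -- Evenness of `m k` at a half-period is what keeps the natural-number division from rounding.
      have hred : (reducedMult L m k : ℝ) = m k / 2 := by
        rw [reducedMult, if_pos hhk, hr, show (r + r) / 2 = r by omega]
        push_cast
        ring
      rw [hred, hφι k hkJ, h]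
      simp
      ring
    · rw [reducedMult, if_neg (fun hhk => h ((hhp k hkJ).1 hhk)), if_pos h]
      ring
  rw [Finset.sum_congr rfl hterm, Finset.sum_add_distrib, ← Finset.sum_filter,
    ← Finset.sum_sdiff hIJ, add_comm]
  congr 1
  -- The terms in `φ (-k)` at non-fixed points of `I` account for the points of `J` outside `I`.
  refine Finset.sum_bij' (fun k _ => ι k) (fun j _ => ι j) ?_ ?_ ?_ ?_ ?_
  · intro k hk
    rw [Finset.mem_filter] at hk
    exact Finset.mem_sdiff.2 ⟨hιJ k (hIJ hk.1), fun h => hk.2 (hmin k hk.1 h)⟩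
  · intro j hj
    rw [Finset.mem_sdiff] at hj
    refine Finset.mem_filter.2 ⟨hcov j hj.1 hj.2, fun h => hj.2 ?_⟩
    rw [hinv j hj.1] at h
    rw [h]
    exact hcov j hj.1 hj.2
  · exact fun k hk => hinv k (hIJ (Finset.mem_filter.1 hk).1)
  · exact fun j hj => hinv j (Finset.mem_sdiff.1 hj).1
  · intro k hk
    have hkJ := hIJ (Finset.mem_filter.1 hk).1
    rw [hιm k hkJ, hφι k hkJ]

/-! ### The explicit product -/

section Product

variable {V J I : Finset ℂ} {m : ℂ → ℕ} {n : ℕ} {G H : ℂ → ℝ}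

/-- The case `φ = 1` of `sum_half_representatives`, with `∑ m_j = n + 2` from the balance condition.
It gives the order `n + 2` of the pole of the product and shows that `n` is even. -/
lemma two_mul_sum_reducedMult
    (hper : IsPeriodicConfiguration L V m) (heven : IsEvenConfiguration L V m)
    (hhalf : ∀ p ∈ V, p = L.ω₁ / 2 ∨ p = L.ω₂ / 2 ∨ p = (L.ω₁ + L.ω₂) / 2 → Even (m p))
    (hJ : IsRepresentatives L V J) (hI : IsHalfRepresentatives L J I)
    (hbalance : n + ∑ j ∈ J, m j = 2 * (n + 1)) :
    2 * ∑ k ∈ I, reducedMult L m k = n + 2 := by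
  have h := sum_half_representatives hper heven hhalf hJ hI (φ := fun _ => 1) (fun _ _ _ => rfl)
  have h2 : (2 * ∑ k ∈ I, reducedMult L m k : ℝ) = ((∑ j ∈ J, m j : ℕ) : ℝ) := by
    push_cast
    rw [Finset.mul_sum]
    simp only [mul_one] at h
    rw [← h]
    exact Finset.sum_congr rfl fun k _ => by ring
  have h3 : 2 * ∑ k ∈ I, reducedMult L m k = ∑ j ∈ J, m j := by exact_mod_cast h2
  omega

/-- The squared modulus of the explicit product. -/
theorem norm_sq_explicitH (hG : IsGreenFunction L G H)
    (hper : IsPeriodicConfiguration L V m) (heven : IsEvenConfiguration L V m)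
    (hhalf : ∀ p ∈ V, p = L.ω₁ / 2 ∨ p = L.ω₂ / 2 ∨ p = (L.ω₁ + L.ω₂) / 2 → Even (m p))
    (hJ : IsRepresentatives L V J) (hI : IsHalfRepresentatives L J I)
    (hbalance : n + ∑ j ∈ J, m j = 2 * (n + 1)) {z : ℂ} (hz : z ∉ L.lattice)
    (hzJ : ∀ j ∈ J, z - j ∉ L.lattice) :
    ‖explicitH L G H n J I m z‖ ^ 2 = weight G n 0 J m id z := by
  have hIJ : I ⊆ J := hI.1.1
  have hsum := fun φ => sum_half_representatives hper heven hhalf hJ hI (φ := φ)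
  have s1 : (2 * ∑ k ∈ I, (reducedMult L m k : ℝ)) = n + 2 := by
    exact_mod_cast two_mul_sum_reducedMult hper heven hhalf hJ hI hbalance
  have s2 := hsum (fun x => G (z - x)) fun x l hl => by
    rw [← hG.periodic (z - (x + l)) l hl]
    congr 1
    ring
  have s3 := hsum (fun x => G (0 - x)) fun x l hl => by
    rw [← hG.periodic (0 - (x + l)) l hl]
    congr 1
    ring
  simp only [sub_neg_eq_add, zero_sub, zero_add] at s2 s3
  have hfac : ∀ k ∈ I, ‖(L.weierstrassP z - L.weierstrassP k) ^ reducedMult L m k‖ =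
      Real.exp (reducedMult L m k * (2 * Real.pi * (2 * G z - G (z - k) - G (z + k)) +
        2 * Real.pi * (G k + G (-k)) - 4 * Real.pi * H 0)) := by
    intro k hk
    have hzk : z + k ∉ L.lattice := by
      intro h
      obtain ⟨j', hj', hs, -⟩ := exists_partner hper heven hJ (hIJ hk)
      refine hzJ j' hj' ?_
      convert L.lattice.sub_mem h hs using 1
      ring
    rw [norm_pow, norm_weierstrassP_sub hG
      (notMem_lattice_of_mem_representatives hper hJ (hIJ hk)) hz (hzJ k (hIJ hk)) hzk,
      ← Real.exp_nat_mul]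
  rw [explicitH, norm_mul, norm_prod, Finset.prod_congr rfl hfac, ← Real.exp_sum, Complex.norm_real,
    Real.norm_eq_abs, lambdaZero, Real.abs_exp, ← Real.exp_add, ← Real.exp_nat_mul, weight, potential]
  congr 1
  simp only [sub_zero, zero_sub, id]
  have e : ∑ k ∈ I, (reducedMult L m k : ℝ) * (2 * Real.pi * (2 * G z - G (z - k) - G (z + k)) +
        2 * Real.pi * (G k + G (-k)) - 4 * Real.pi * H 0) =
      (4 * Real.pi * G z - 4 * Real.pi * H 0) * (∑ k ∈ I, (reducedMult L m k : ℝ)) -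
      2 * Real.pi * (∑ k ∈ I, (reducedMult L m k : ℝ) * (G (z - k) + G (z + k))) +
      2 * Real.pi * ∑ k ∈ I, (reducedMult L m k : ℝ) * (G (-k) + G k) := by
    simp only [Finset.mul_sum, ← Finset.sum_sub_distrib, ← Finset.sum_add_distrib]
    exact Finset.sum_congr rfl fun k _ => by ring
  -- After squaring, `G z` gets the coefficient `4π(n + 2) = -4πn + 8π(n + 1)`, while the terms in
  -- `H 0` and `G (-j)` cancel against `λ₀`.
  rw [e, s2, s3]
  push_cast
  linear_combination (4 * Real.pi * G z - 4 * Real.pi * H 0) * s1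

lemma explicitH_add_lattice (z : ℂ) {l : ℂ} (hl : l ∈ L.lattice) :
    explicitH L G H n J I m (z + l) = explicitH L G H n J I m z := by
  simp only [explicitH, weierstrassP_add_lattice z hl]

lemma differentiableOn_explicitH :
    DifferentiableOn ℂ (explicitH L G H n J I m) (L.lattice : Set ℂ)ᶜ :=
  (differentiableOn_const _).mul (DifferentiableOn.fun_finsetProd fun _ _ =>
    (L.differentiableOn_weierstrassP.sub (differentiableOn_const _)).pow _)

/-- The explicit product is an even holomorphic function divided by a power of `z²`. -/
lemma exists_explicitH_eq_div :
    ∃ g : ℂ → ℂ, DifferentiableOn ℂ g (twoOmega L) ∧ (∀ z, g (-z) = g z) ∧ g 0 ≠ 0 ∧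
      ∀ z, z ≠ 0 → explicitH L G H n J I m z =
        g z / z ^ (2 * ∑ k ∈ I, reducedMult L m k) := by
  have hdiff : DifferentiableOn ℂ (L.weierstrassPExcept 0) (twoOmega L) := by
    refine (L.differentiableOn_weierstrassPExcept 0).mono fun z hz hz' => hz'.2 ?_
    exact eq_zero_of_mem_lattice_of_mem_cell hz'.1 hz
  -- Off the origin each factor is `z² (℘(z) - ℘(k))`. It extends by `1` to the origin, so `g 0 =
  -- λ₀`.
  refine ⟨fun z => (lambdaZero G H n J m : ℂ) * ∏ k ∈ I,
    (z ^ 2 * (L.weierstrassPExcept 0 z - L.weierstrassP k) + 1) ^ reducedMult L m k, ?_, ?_, ?_, ?_⟩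
  · exact (differentiableOn_const _).mul (DifferentiableOn.fun_finsetProd fun _ _ =>
      (((differentiableOn_id.pow 2).mul (hdiff.sub (differentiableOn_const _))).add
        (differentiableOn_const _)).pow _)
  · intro z
    simp only [neg_sq, L.weierstrassPExcept_neg, neg_zero]
  · simp [lambdaZero]
  · intro z hz
    have hP := L.weierstrassPExcept_add 0 z
    simp only [ZeroMemClass.coe_zero, sub_zero] at hP
    rw [explicitH, mul_div_assoc]
    congr 1
    rw [Finset.mul_sum, ← Finset.prod_pow_eq_pow_sum, ← Finset.prod_div_distrib]
    refine Finset.prod_congr rfl fun k _ => ?_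
    rw [pow_mul, ← div_pow, ← hP]
    congr 1
    field_simp
    simp
    ring

end Product

end TorusVortex

end

noncomputable section

namespace TorusVortex

variable {L : PeriodPair}

/-! ### The truncated integrals -/

lemma volume_real_ball (a : ℂ) {r : ℝ} (hr : 0 ≤ r) :
    volume.real (Metric.ball a r) = Real.pi * r ^ 2 := by
  rw [Measure.real, Complex.volume_ball, ENNReal.toReal_mul, ENNReal.toReal_pow,
    ENNReal.toReal_ofReal hr, mul_comm]
  rfl

lemma volume_real_closedBall (a : ℂ) {r : ℝ} (hr : 0 ≤ r) :
    volume.real (Metric.closedBall a r) = Real.pi * r ^ 2 := by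
  rw [Measure.real, Complex.volume_closedBall, ENNReal.toReal_mul, ENNReal.toReal_pow,
    ENNReal.toReal_ofReal hr, mul_comm]
  rfl

/-- Polar coordinates. The value is `a` times the area of the disc of radius `1/ρ`, onto which
inversion maps the domain (up to its centre). -/
lemma integral_compl_ball_inv_pow_four (a : ℝ) {ρ : ℝ} (hρ : 0 < ρ) :
    ∫ y in (Metric.ball (0 : ℂ) ρ)ᶜ, a / ‖y‖ ^ 4 = a * (Real.pi * (1 / ρ) ^ 2) := by
  have h1 : ∫ y in (Metric.ball (0 : ℂ) ρ)ᶜ, a / ‖y‖ ^ 4 =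
      ∫ y : ℂ, (Set.Ici ρ).indicator (fun r : ℝ => a / r ^ 4) ‖y‖ := by
    rw [← integral_indicator Metric.isOpen_ball.measurableSet.compl]
    congr 1 with y
    by_cases h : ρ ≤ ‖y‖
    · rw [Set.indicator_of_mem (by simpa using h), Set.indicator_of_mem (Set.mem_Ici.2 h)]
    · rw [Set.indicator_of_notMem (by simpa using h), Set.indicator_of_notMem (by simpa using h)]
  have h2 : ∫ y in Set.Ioi (0 : ℝ), y ^ (Module.finrank ℝ ℂ - 1) •
      (Set.Ici ρ).indicator (fun r : ℝ => a / r ^ 4) y = ∫ y in Set.Ioi ρ, a * y ^ (-3 : ℝ) := by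
    rw [← integral_Ici_eq_integral_Ioi, ← integral_Ici_eq_integral_Ioi,
      ← integral_indicator measurableSet_Ici, ← integral_indicator measurableSet_Ici]
    congr 1 with y
    by_cases h : ρ ≤ y
    · have hy : 0 < y := hρ.trans_le h
      rw [Set.indicator_of_mem (Set.mem_Ici.2 hy.le), Set.indicator_of_mem (Set.mem_Ici.2 h),
        Set.indicator_of_mem (Set.mem_Ici.2 h), Complex.finrank_real_complex,
        Real.rpow_neg hy.le]
      norm_num
      field_simp
    · rw [Set.indicator_of_notMem (s := Set.Ici ρ) (f := fun y : ℝ => a * y ^ (-3 : ℝ)) (by simpa using h)]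
      by_cases h' : 0 ≤ y
      · rw [Set.indicator_of_mem (Set.mem_Ici.2 h'), Set.indicator_of_notMem (by simpa using h), smul_zero]
      · rw [Set.indicator_of_notMem (by simpa using h')]
  rw [h1, integral_fun_norm_addHaar volume, h2, integral_const_mul,
    integral_Ioi_rpow_of_lt (by norm_num) hρ, volume_real_ball 0 zero_le_one,
    Complex.finrank_real_complex, show (-3 + 1 : ℝ) = -2 by norm_num, Real.rpow_neg hρ.le]
  norm_num
  ring

lemma measurableSet_inter_preimage_of_continuousOn {f : ℂ → ℂ} {W A : Set ℂ}
    (hW : MeasurableSet W) (hf : ContinuousOn f W) (hA : MeasurableSet A) :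
    MeasurableSet (W ∩ f ⁻¹' A) := by
  have h := (continuousOn_iff_continuous_domRestrict.1 hf).measurable hA
  have := (MeasurableEmbedding.subtype_coe hW).measurableSet_image.2 h
  convert this using 1
  ext z
  simp [and_comm]

/-- Since `|c| = 1`, the second condition describes a disc of radius `R` about `-d/c`, and `R₀ + ‖d‖
< R` makes it contain the removed disc. The area does not depend on `c` or `d`, hence not on the
constant of integration. -/
lemma volume_annulus {R₀ R : ℝ} (hR₀ : 0 < R₀) {c d : ℂ} (hc : ‖c‖ = 1) (hR : R₀ + ‖d‖ < R) :
    MeasurableSet {w : ℂ | R₀ < ‖w‖ ∧ ‖c * w + d‖ ≤ R} ∧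
    volume {w : ℂ | R₀ < ‖w‖ ∧ ‖c * w + d‖ ≤ R} =
      ENNReal.ofReal (Real.pi * R ^ 2 - Real.pi * R₀ ^ 2) := by
  have hc0 : c ≠ 0 := norm_ne_zero_iff.1 (by rw [hc]; exact one_ne_zero)
  have hnorm : ∀ w : ℂ, ‖c * w + d‖ = ‖w - -(d / c)‖ := by
    intro w
    rw [show c * w + d = c * (w - -(d / c)) by field_simp; ring, norm_mul, hc, one_mul]
  have hset : {w : ℂ | R₀ < ‖w‖ ∧ ‖c * w + d‖ ≤ R} =
      Metric.closedBall (-(d / c)) R \ Metric.closedBall 0 R₀ := by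
    ext w
    simp [hnorm w, dist_eq_norm, and_comm]
  have hsub : Metric.closedBall (0 : ℂ) R₀ ⊆ Metric.closedBall (-(d / c)) R := by
    intro w hw
    rw [mem_closedBall_zero_iff] at hw
    rw [Metric.mem_closedBall, dist_eq_norm, ← hnorm]
    refine (norm_add_le _ _).trans ?_
    rw [norm_mul, hc, one_mul]
    linarith
  have hRpos : 0 ≤ R := by linarith [norm_nonneg d]
  rw [hset]
  refine ⟨Metric.isClosed_closedBall.measurableSet.diff Metric.isClosed_closedBall.measurableSet, ?_⟩
  rw [← ENNReal.ofReal_toReal (a := volume (Metric.closedBall (-(d / c)) R \ Metric.closedBall 0 R₀))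
    (measure_ne_top_of_subset Set.sdiff_subset (isCompact_closedBall _ _).measure_lt_top.ne)]
  congr 1
  have := measureReal_sdiff (μ := volume) hsub Metric.isClosed_closedBall.measurableSet
    ((isCompact_closedBall _ _).measure_lt_top.ne)
  rw [volume_real_closedBall _ hRpos, volume_real_closedBall _ hR₀.le] at this
  exact this

/-- The integral of `|h|²` over `{|c S + d| ≤ R}` in a translated cell, for a periodic `h` with
antiderivative `-S` that is `N`-to-one near infinity. -/
lemma integral_truncated {h S : ℂ → ℂ} {N : ℕ} {R₀ : ℝ}
    (hper : ∀ z, ∀ l ∈ L.lattice, h (z + l) = h z)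
    (hcont : ContinuousOn h (twoOmega L \ {0}))
    (hS : IsInvSigma (twoOmega L) 0 h S)
    (hcrit : {z | z ∈ twoOmega L \ {0} ∧ h z = 0}.Countable)
    (hR₀ : 0 < R₀) (hV : ∀ z ∈ cell L (3 / 4), z ≠ 0 → R₀ < ‖S z‖ → z ∈ cell L (1 / 4))
    (hN : ∀ w, R₀ < ‖w‖ → {z | z ∈ cell L (3 / 4) ∧ z ≠ 0 ∧ S z = w}.encard = N)
    (hinf : ∀ᶠ z in 𝓝[≠] 0, R₀ < ‖S z‖)
    {τ c d : ℂ} {R : ℝ} (hτ : τ ∈ cell L (1 / 4)) (hc : ‖c‖ = 1) (hR : R₀ + ‖d‖ < R) :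
    MeasurableSet {z | z + τ ∈ Omega L ∧ z ≠ 0 ∧ ‖c * S z + d‖ ≤ R} ∧
    IntegrableOn (fun z => ‖h z‖ ^ 2) {z | z + τ ∈ Omega L ∧ z ≠ 0 ∧ ‖c * S z + d‖ ≤ R} ∧
    ∫ z in {z | z + τ ∈ Omega L ∧ z ≠ 0 ∧ ‖c * S z + d‖ ≤ R}, ‖h z‖ ^ 2 =
      (∫ z in {z | z ∈ Omega L ∧ z ≠ 0 ∧ ‖S z‖ ≤ R₀}, ‖h z‖ ^ 2) +
        N * (Real.pi * R ^ 2 - Real.pi * R₀ ^ 2) := by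
  have hopen1 : IsOpen (twoOmega L \ {0}) := (isOpen_cell 1).sdiff isClosed_singleton
  have hopen34 : IsOpen (cell L (3 / 4) \ {0}) := (isOpen_cell _).sdiff isClosed_singleton
  have h341 : cell L (3 / 4) ⊆ twoOmega L := cell_mono (by norm_num)
  have hd : ∀ z ∈ twoOmega L \ {0}, HasDerivAt S (-h z) z := fun z hz => hS z hz.1 hz.2
  have hScont : ContinuousOn S (twoOmega L \ {0}) := fun z hz =>
    (hd z hz).continuousAt.continuousWithinAt
  have hsq : ContinuousOn (fun z => ‖h z‖ ^ 2) (twoOmega L \ {0}) := hcont.norm.pow 2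
  -- The sizes are chosen so that a cell translated by a point of the quarter cell stays in the
  -- `3/4` cell, the `3/4` and quarter cells add up to `2Ω`, and two quarter cells add up to `Ω`.
  have hΩ : ∀ {σ : ℂ}, σ ∈ cell L (1 / 4) → ∀ z, z + σ ∈ Omega L → z ∈ cell L (3 / 4) := by
    intro σ hσ z hz
    have := sub_mem_cell hz hσ
    norm_num at this
    exact this
  obtain ⟨hAm, hAv⟩ := volume_annulus hR₀ hc hR
  set A := {w : ℂ | R₀ < ‖w‖ ∧ ‖c * w + d‖ ≤ R} with hA
  have hπ : 0 ≤ Real.pi * R ^ 2 - Real.pi * R₀ ^ 2 := by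
    have : R₀ ≤ R := by linarith [norm_nonneg d]
    have : R₀ ^ 2 ≤ R ^ 2 := pow_le_pow_left₀ hR₀.le this 2
    nlinarith [Real.pi_pos]
  -- the part near the pole
  set T2 := (cell L (3 / 4) \ {0}) ∩ S ⁻¹' A with hT2
  have hT2m : MeasurableSet T2 := measurableSet_inter_preimage_of_continuousOn hopen34.measurableSet
    (hScont.mono (Set.sdiff_subset_sdiff_left h341)) hAm
  have hT2sub : T2 ⊆ twoOmega L \ {0} := fun z hz => ⟨h341 hz.1.1, hz.1.2⟩
  have hlint : ∫⁻ z in T2, ENNReal.ofReal (‖h z‖ ^ 2) =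
      ENNReal.ofReal (N * (Real.pi * R ^ 2 - Real.pi * R₀ ^ 2)) := by
    have harea := areaWithMultiplicity_eq_lintegral (A := T2) hopen1 hd
      (by simpa only [neg_eq_zero] using hcrit) hT2m hT2sub
    simp only [norm_neg] at harea
    rw [← harea, areaWithMultiplicity]
    have : ∀ w : ℂ, (({z | z ∈ T2 ∧ S z = w}.encard : ℕ∞) : ℝ≥0∞) =
        A.indicator (fun _ => (N : ℝ≥0∞)) w := by
      intro w
      by_cases hw : w ∈ A
      · have e : {z | z ∈ T2 ∧ S z = w} = {z | z ∈ cell L (3 / 4) ∧ z ≠ 0 ∧ S z = w} := by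
          ext z
          constructor
          · rintro ⟨⟨h1, -⟩, h2⟩
            exact ⟨h1.1, h1.2, h2⟩
          · rintro ⟨h1, h2, h3⟩
            exact ⟨⟨⟨h1, h2⟩, by rw [Set.mem_preimage, h3]; exact hw⟩, h3⟩
        rw [Set.indicator_of_mem hw, e, hN w hw.1]
        simp
      · have e : {z | z ∈ T2 ∧ S z = w} = ∅ := by
          ext z
          simp only [Set.mem_ofPred_eq, Set.mem_empty_iff_false, iff_false]
          rintro ⟨⟨-, h1⟩, h2⟩
          exact hw (h2 ▸ h1)
        rw [Set.indicator_of_notMem hw, e]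
        simp
    simp_rw [this]
    rw [lintegral_indicator_const hAm, hAv, ENNReal.ofReal_mul (Nat.cast_nonneg N),
      ENNReal.ofReal_natCast]
  have hT2i : IntegrableOn (fun z => ‖h z‖ ^ 2) T2 := by
    refine ⟨(hsq.mono hT2sub).aestronglyMeasurable hT2m, ?_⟩
    rw [hasFiniteIntegral_iff_ofReal (Eventually.of_forall fun z => by positivity), hlint]
    exact ENNReal.ofReal_lt_top
  have hT2int : ∫ z in T2, ‖h z‖ ^ 2 = N * (Real.pi * R ^ 2 - Real.pi * R₀ ^ 2) := by
    rw [integral_eq_lintegral_of_nonneg_ae (Eventually.of_forall fun z => by positivity) hT2i.1, hlint,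
      ENNReal.toReal_ofReal (by positivity)]
  -- the part away from the pole
  obtain ⟨r, hr, hball⟩ := Metric.mem_nhds_iff.1 (eventually_nhdsWithin_iff.1 hinf)
  -- `S` is not periodic, so the condition `‖S z‖ ≤ R₀` is replaced by a lattice-invariant one: it
  -- must hold for every lattice translate of `z` lying in the `3/4` cell. In a translated cell
  -- nothing changes, since a violating translate `z - l` lies in the quarter cell, which forces `l
  -- = 0`. The integral then does not depend on `σ`.
  have hT1 : ∀ {σ : ℂ}, σ ∈ cell L (1 / 4) →
      MeasurableSet {z | z + σ ∈ Omega L ∧ z ≠ 0 ∧ ‖S z‖ ≤ R₀} ∧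
      IntegrableOn (fun z => ‖h z‖ ^ 2) {z | z + σ ∈ Omega L ∧ z ≠ 0 ∧ ‖S z‖ ≤ R₀} ∧
      ∫ z in {z | z + σ ∈ Omega L ∧ z ≠ 0 ∧ ‖S z‖ ≤ R₀}, ‖h z‖ ^ 2 =
        ∫ z in Omega L, {z | ∀ l ∈ L.lattice, z - l ∈ cell L (3 / 4) → z - l ≠ 0 ∧
          ‖S (z - l)‖ ≤ R₀}.indicator (fun z => ‖h z‖ ^ 2) z := by
    intro σ hσ
    have hDo : IsOpen {z | z + σ ∈ Omega L} :=
      (isOpen_cell (L := L) (1 / 2)).preimage (continuous_add_const σ)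
    have hDm : MeasurableSet {z | z + σ ∈ Omega L ∧ z ≠ 0 ∧ ‖S z‖ ≤ R₀} := by
      have h1 : MeasurableSet (({z | z + σ ∈ Omega L} \ {0}) ∩ S ⁻¹' Metric.closedBall 0 R₀) :=
        measurableSet_inter_preimage_of_continuousOn (hDo.sdiff isClosed_singleton).measurableSet
          (hScont.mono fun z hz => ⟨h341 (hΩ hσ z hz.1), hz.2⟩)
          Metric.isClosed_closedBall.measurableSet
      convert h1 using 1
      ext z
      simp [and_assoc]
    refine ⟨hDm, ?_, ?_⟩
    · have hcomp : IsCompact (closedCell L (3 / 4) \ Metric.ball 0 r) :=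
        (isCompact_closedCell _).diff Metric.isOpen_ball
      refine ((hsq.mono ?_).integrableOn_compact hcomp).mono_set ?_
      · exact fun z hz => ⟨closedCell_subset_cell (by norm_num) hz.1, fun h0 => hz.2 (by
          rw [Set.mem_singleton_iff.1 h0]; exact Metric.mem_ball_self hr)⟩
      · exact fun z hz => ⟨cell_subset_closedCell _ (hΩ hσ z hz.1), fun hb =>
          absurd (hball hb hz.2.1) (not_lt.2 hz.2.2)⟩
    · rw [← setIntegral_translate_Omega σ (L := L)]
      · have hkey : ∀ z ∈ {z | z + σ ∈ Omega L},
            {z | ∀ l ∈ L.lattice, z - l ∈ cell L (3 / 4) → z - l ≠ 0 ∧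
              ‖S (z - l)‖ ≤ R₀}.indicator (fun z => ‖h z‖ ^ 2) z =
            {z | z + σ ∈ Omega L ∧ z ≠ 0 ∧ ‖S z‖ ≤ R₀}.indicator (fun z => ‖h z‖ ^ 2) z := by
          intro z hz
          have hz34 := hΩ hσ z hz
          by_cases hzz : z ≠ 0 ∧ ‖S z‖ ≤ R₀
          · rw [Set.indicator_of_mem, Set.indicator_of_mem (show z ∈ {z | z + σ ∈ Omega L ∧ z ≠ 0 ∧ ‖S z‖ ≤ R₀} from ⟨hz, hzz⟩)]
            intro l hl hzl
            by_contra hcon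
            have h14 : z - l ∈ cell L (1 / 4) := by
              by_cases h0 : z - l = 0
              · rw [h0]
                exact zero_mem_cell (by norm_num)
              · exact hV _ hzl h0 (not_le.1 fun hle => hcon ⟨h0, hle⟩)
            have hl1 := sub_mem_cell hz34 h14
            norm_num at hl1
            have := eq_zero_of_mem_lattice_of_mem_cell hl hl1
            rw [this, sub_zero] at hcon
            exact hcon hzz
          · rw [Set.indicator_of_notMem, Set.indicator_of_notMem (fun h => hzz h.2)]
            intro hall
            have := hall 0 L.lattice.zero_mem (by rwa [sub_zero])
            rw [sub_zero] at this
            exact hzz this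
        rw [setIntegral_congr_fun hDo.measurableSet hkey, setIntegral_indicator hDm]
        congr 2
        ext z
        simp only [Set.mem_inter_iff, Set.mem_ofPred_eq]
        tauto
      · intro z l hl
        simp only [Set.indicator, hper z l hl]
        congr 1
        apply propext
        constructor
        · intro hz l' hl'
          have := hz (l + l') (L.lattice.add_mem hl hl')
          rwa [show z + l - (l + l') = z - l' by ring] at this
        · intro hz l' hl'
          have := hz (l' - l) (L.lattice.sub_mem hl' hl)
          rwa [show z - (l' - l) = z + l - l' by ring] at this
  obtain ⟨hT1m, hT1i, hT1int⟩ := hT1 hτ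
  obtain ⟨-, -, hT0int⟩ := hT1 (σ := 0) (zero_mem_cell (by norm_num))
  simp only [add_zero] at hT0int
  -- The region with `‖S‖ > R₀` lies in the quarter cell, hence inside every translated cell
  -- considered; it is the same set `T2` for all `τ`.
  have hsplit : {z | z + τ ∈ Omega L ∧ z ≠ 0 ∧ ‖c * S z + d‖ ≤ R} =
      {z | z + τ ∈ Omega L ∧ z ≠ 0 ∧ ‖S z‖ ≤ R₀} ∪ T2 := by
    ext z
    constructor
    · rintro ⟨h1, h2, h3⟩
      by_cases h4 : ‖S z‖ ≤ R₀
      · exact Or.inl ⟨h1, h2, h4⟩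
      · exact Or.inr ⟨⟨hΩ hτ z h1, h2⟩, not_le.1 h4, h3⟩
    · rintro (⟨h1, h2, h3⟩ | ⟨⟨h1, h2⟩, h3, h4⟩)
      · refine ⟨h1, h2, (norm_add_le _ _).trans ?_⟩
        rw [norm_mul, hc, one_mul]
        linarith
      · refine ⟨?_, h2, h4⟩
        have := add_mem_cell (hV z h1 h2 h3) hτ
        norm_num at this
        exact this
  have hdisj : Disjoint {z | z + τ ∈ Omega L ∧ z ≠ 0 ∧ ‖S z‖ ≤ R₀} T2 :=
    Set.disjoint_left.2 fun z hz hz' => absurd hz'.2.1 (not_lt.2 hz.2.2)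
  rw [hsplit]
  exact ⟨hT1m.union hT2m, hT1i.union hT2i, by
    rw [setIntegral_union hdisj hT2m hT1i hT2i, hT1int, ← hT0int, hT2int]⟩

end TorusVortex

end

noncomputable section

namespace TorusVortex

variable {L : PeriodPair} {G : ℂ → ℝ} {n : ℕ} {J : Finset ℂ} {m : ℂ → ℕ} {p : ℂ → ℂ} {τ : ℂ}

/-! ### Translated configurations -/

lemma weight_translate (hper : ∀ z : ℂ, ∀ l ∈ L.lattice, G (z + l) = G z)
    (hp : ∀ j ∈ J, p j - (j + τ) ∈ L.lattice) (z : ℂ) :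
    weight G n τ J m p z = weight G n 0 J m id (z - τ) := by
  have hs : ∑ j ∈ J, (m j : ℝ) * G (z - p j) = ∑ j ∈ J, (m j : ℝ) * G (z - τ - id j) := by
    refine Finset.sum_congr rfl fun j hj => ?_
    rw [← hper (z - p j) _ (hp j hj)]
    congr 2
    simp only [id]
    ring
  simp only [weight, potential, hs, sub_zero]

lemma eq_of_sub_mem_lattice {z q : ℂ} (hz : z ∈ Omega L) (hq : q ∈ closure (Omega L))
    (h : z - q ∈ L.lattice) : z = q := by
  rw [mem_closure_Omega] at hq
  refine sub_eq_zero.1 (eq_zero_of_mem_lattice_of_mem_cell h (mem_cell.2 ?_))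
  have h1 := mem_cell.1 hz
  rw [map_sub, map_sub]
  exact ⟨(abs_sub _ _).trans_lt (by linarith [h1.1, hq.1]),
    (abs_sub _ _).trans_lt (by linarith [h1.2, hq.2])⟩

lemma sub_mem_twoOmega {z : ℂ} (hz : z ∈ Omega L) (hτ : τ ∈ Omega L) : z - τ ∈ twoOmega L := by
  have := sub_mem_cell hz hτ
  norm_num at this
  exact this

lemma sub_notMem_lattice {z : ℂ} (hz : z ∈ Omega L) (hτ : τ ∈ Omega L) (hne : z ≠ τ) :
    z - τ ∉ L.lattice := fun h =>
  hne (sub_eq_zero.1 (eq_zero_of_mem_lattice_of_mem_cell h (sub_mem_twoOmega hz hτ)))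

variable {h : ℂ → ℂ}

/-- The points `p j` are allowed in the closed cell so that the untranslated configuration, whose
points may lie on the boundary, is covered too. -/
lemma weight_eq_norm_sq (hper : ∀ z : ℂ, ∀ l ∈ L.lattice, G (z + l) = G z)
    (hw : ∀ z, z ∉ L.lattice → (∀ j ∈ J, z - j ∉ L.lattice) → ‖h z‖ ^ 2 = weight G n 0 J m id z)
    (hτ : τ ∈ Omega L) (hp : ∀ j ∈ J, p j ∈ closure (Omega L) ∧ p j - (j + τ) ∈ L.lattice)
    {z : ℂ} (hz : z ∈ Omega L) (hzτ : z ≠ τ) (hzp : ∀ j ∈ J, z ≠ p j) :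
    weight G n τ J m p z = ‖h (z - τ)‖ ^ 2 := by
  rw [weight_translate hper fun j hj => (hp j hj).2]
  refine (hw _ (sub_notMem_lattice hz hτ hzτ) fun j hj hl => hzp j hj ?_).symm
  refine eq_of_sub_mem_lattice hz (hp j hj).1 ?_
  convert L.lattice.sub_mem hl (hp j hj).2 using 1
  ring

/-- The functions with the prescribed modulus are the rotations of a translate of `h`. -/
lemma isHZero_iff (hper : ∀ z : ℂ, ∀ l ∈ L.lattice, G (z + l) = G z)
    (hdiff : DifferentiableOn ℂ h (L.lattice : Set ℂ)ᶜ) (hmer : MeromorphicAt h 0)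
    (hw : ∀ z, z ∉ L.lattice → (∀ j ∈ J, z - j ∉ L.lattice) → ‖h z‖ ^ 2 = weight G n 0 J m id z)
    (hτ : τ ∈ Omega L) (hp : ∀ j ∈ J, p j ∈ closure (Omega L) ∧ p j - (j + τ) ∈ L.lattice)
    {K : ℂ → ℂ} :
    IsHZero L G n τ J m p K ↔ ∃ c : ℂ, ‖c‖ = 1 ∧ ∀ z ∈ Omega L, z ≠ τ → K z = c * h (z - τ) := by
  have hopenΩ : IsOpen (Omega L) := isOpen_cell _
  have hopen : IsOpen (Omega L \ {τ}) := hopenΩ.sdiff isClosed_singleton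
  have hconn : IsPreconnected (Omega L \ {τ}) :=
    isPreconnected_sdiff_singleton hopenΩ (convex_cell _) τ
  have hhd : DifferentiableOn ℂ (fun z => h (z - τ)) (Omega L \ {τ}) :=
    hdiff.comp (differentiableOn_id.sub_const τ) fun z hz => sub_notMem_lattice hz.1 hτ hz.2
  constructor
  · intro hK
    have hnorm : ∀ z ∈ Omega L \ {τ}, ‖K z‖ = ‖h (z - τ)‖ := by
      intro z hz
      -- The modulus is prescribed only off the finitely many `p j`; continuity of both sides
      -- extends the equality to them.
      have hev : ∀ᶠ w in 𝓝[≠] z, ‖K w‖ = ‖h (w - τ)‖ := by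
        have h1 : ∀ᶠ w in 𝓝 z, w ∉ ((J.image p : Finset ℂ) : Set ℂ) \ {z} :=
          (((J.image p).finite_toSet.subset Set.sdiff_subset).isClosed.isOpen_compl).mem_nhds
            fun hz' => hz'.2 rfl
        filter_upwards [nhdsWithin_le_nhds h1, nhdsWithin_le_nhds (hopen.mem_nhds hz),
          self_mem_nhdsWithin] with w hw1 hw2 hw3
        have hwp : ∀ j ∈ J, w ≠ p j := fun j hj hwj =>
          hw1 ⟨Finset.mem_coe.2 (Finset.mem_image.2 ⟨j, hj, hwj.symm⟩), hw3⟩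
        refine (sq_eq_sq₀ (norm_nonneg _) (norm_nonneg _)).1 ?_
        rw [hK.norm_sq w hw2.1 hw2.2 hwp, weight_eq_norm_sq hper hw hτ hp hw2.1 hw2.2 hwp]
      have c1 := (hK.holo.continuousOn.continuousAt (hopen.mem_nhds hz)).norm.tendsto.mono_left
        (nhdsWithin_le_nhds (s := {z}ᶜ))
      have c2 := (hhd.continuousOn.continuousAt (hopen.mem_nhds hz)).norm.tendsto.mono_left
        (nhdsWithin_le_nhds (s := {z}ᶜ))
      exact tendsto_nhds_unique (c1.congr' hev) c2
    obtain ⟨c, hc, hcz⟩ := exists_eq_const_mul_of_norm_eq hopen hconn hK.holo hhd hnorm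
    exact ⟨c, hc, fun z hz hzτ => hcz z ⟨hz, hzτ⟩⟩
  · rintro ⟨c, hc, hcz⟩
    refine ⟨?_, ?_, ?_⟩
    · exact (hhd.const_mul c).congr fun z hz => hcz z hz.1 hz.2
    · have hsh : MeromorphicAt (fun z => h (z - τ)) τ :=
        MeromorphicAt.comp_analyticAt (f := h) (g := fun z => z - τ) (by simpa using hmer)
          (analyticAt_id.sub analyticAt_const)
      refine ((MeromorphicAt.const c τ).mul hsh).congr ?_
      filter_upwards [nhdsWithin_le_nhds (hopenΩ.mem_nhds hτ), self_mem_nhdsWithin] with z h1 h2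
      exact (hcz z h1 h2).symm
    · intro z hz hzτ hzp
      rw [hcz z hz hzτ, norm_mul, hc, one_mul, weight_eq_norm_sq hper hw hτ hp hz hzτ hzp]

/-- The coefficient of a translated configuration, from the truncated integrals of `|h|²`. -/
lemma isCoefficient_translate (hper : ∀ z : ℂ, ∀ l ∈ L.lattice, G (z + l) = G z)
    (hdiff : DifferentiableOn ℂ h (L.lattice : Set ℂ)ᶜ) (hmer : MeromorphicAt h 0)
    (hw : ∀ z, z ∉ L.lattice → (∀ j ∈ J, z - j ∉ L.lattice) → ‖h z‖ ^ 2 = weight G n 0 J m id z)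
    (hτ : τ ∈ Omega L) (hp : ∀ j ∈ J, p j ∈ closure (Omega L) ∧ p j - (j + τ) ∈ L.lattice)
    {S₀ : ℂ → ℂ} (hS₀ : IsInvSigma (twoOmega L) 0 h S₀) {B R₀ : ℝ}
    (hint : ∀ c d : ℂ, ∀ R : ℝ, ‖c‖ = 1 → R₀ + ‖d‖ < R →
      MeasurableSet {z | z + τ ∈ Omega L ∧ z ≠ 0 ∧ ‖c * S₀ z + d‖ ≤ R} ∧
      IntegrableOn (fun z => ‖h z‖ ^ 2) {z | z + τ ∈ Omega L ∧ z ≠ 0 ∧ ‖c * S₀ z + d‖ ≤ R} ∧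
      ∫ z in {z | z + τ ∈ Omega L ∧ z ≠ 0 ∧ ‖c * S₀ z + d‖ ≤ R}, ‖h z‖ ^ 2 =
        B + (n + 1) * (Real.pi * R ^ 2)) :
    IsCoefficient L G n τ J m p (1 / Real.pi * B) := by
  have hopenΩ : IsOpen (Omega L) := isOpen_cell _
  have hopen : IsOpen (Omega L \ {τ}) := hopenΩ.sdiff isClosed_singleton
  have hconn : IsPreconnected (Omega L \ {τ}) :=
    isPreconnected_sdiff_singleton hopenΩ (convex_cell _) τ
  have hshift : ∀ z ∈ Omega L \ {τ}, HasDerivAt (fun z => S₀ (z - τ)) (-h (z - τ)) z :=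
    fun z hz => (hS₀ (z - τ) (sub_mem_twoOmega hz.1 hτ) (sub_ne_zero.2 hz.2)).comp_sub_const z τ
  refine ⟨⟨fun z => h (z - τ), fun z => S₀ (z - τ), ?_, fun z hz hzτ => hshift z ⟨hz, hzτ⟩⟩, ?_⟩
  · exact (isHZero_iff hper hdiff hmer hw hτ hp).2 ⟨1, by simp, fun z _ _ => (one_mul _).symm⟩
  intro K S hK hS
  obtain ⟨c, hc, hcz⟩ := (isHZero_iff hper hdiff hmer hw hτ hp).1 hK
  -- Every admissible `S` is `c S₀(· - τ) + d`, so translation by `τ` turns the truncated cell into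
  -- the set in `hint` with `R = 1/ρ`.
  obtain ⟨d, hd⟩ := exists_eq_add_const hopen hconn (f := S) (g := fun z => c * S₀ (z - τ))
    (f' := fun z => -K z) (fun z hz => hS z hz.1 hz.2)
    (fun z hz => ((hshift z hz).const_mul c).congr_deriv (by rw [hcz z hz.1 hz.2]; ring))
  have hlarge : ∀ᶠ ρ : ℝ in 𝓝[>] 0, R₀ + ‖d‖ < ρ⁻¹ :=
    tendsto_inv_nhdsGT_zero.eventually_gt_atTop _
  filter_upwards [hlarge, self_mem_nhdsWithin] with ρ hρR hρ
  have hρ' : 0 < ρ := hρ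
  rw [← one_div] at hρR
  obtain ⟨hTm, hTi, hTint⟩ := hint c d (1 / ρ) hc hρR
  set T := {z | z + τ ∈ Omega L ∧ z ≠ 0 ∧ ‖c * S₀ z + d‖ ≤ 1 / ρ} with hT
  have htr : truncated L τ S ρ = (fun z => z - τ) ⁻¹' T := by
    ext z
    simp only [truncated, hT, Set.mem_ofPred_eq, Set.mem_preimage, sub_add_cancel, sub_ne_zero]
    refine and_congr_right fun h1 => and_congr_right fun h2 => ?_
    rw [hd z ⟨h1, h2⟩]
  have hmp : MeasurePreserving (fun z : ℂ => z - τ) := measurePreserving_sub_right volume τ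
  have hemb : MeasurableEmbedding (fun z : ℂ => z - τ) := measurableEmbedding_subRight τ
  have hae : (fun z => ‖h (z - τ)‖ ^ 2) =ᵐ[volume.restrict (truncated L τ S ρ)]
      weight G n τ J m p := by
    have hfin : ∀ᵐ z : ℂ, z ∉ ((J.image p : Finset ℂ) : Set ℂ) :=
      ((J.image p).finite_toSet.countable).ae_notMem volume
    have hm : MeasurableSet (truncated L τ S ρ) := by
      rw [htr]
      exact hmp.measurable hTm
    filter_upwards [ae_restrict_of_ae hfin, ae_restrict_mem hm] with z h1 h2
    exact (weight_eq_norm_sq hper hw hτ hp h2.1 h2.2.1 fun j hj hz =>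
      h1 (Finset.mem_coe.2 (Finset.mem_image.2 ⟨j, hj, hz.symm⟩))).symm
  have hI : IntegrableOn (fun z => ‖h (z - τ)‖ ^ 2) (truncated L τ S ρ) := by
    rw [htr]
    exact (hmp.integrableOn_comp_preimage hemb).2 hTi
  refine ⟨Integrable.congr hI hae, ?_⟩
  have hval : ∫ z in truncated L τ S ρ, weight G n τ J m p z = B + (n + 1) * (Real.pi * (1 / ρ) ^ 2) := by
    rw [← integral_congr_ae hae, htr, ← hTint]
    exact hmp.setIntegral_preimage_emb hemb (fun z => ‖h z‖ ^ 2) T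
  rw [coefficientAt, hval, integral_compl_ball_inv_pow_four _ hρ']
  ring

end TorusVortex

end

/-! ### Antiderivative of the explicit product and the main theorem -/

namespace TorusVortex

variable {L : PeriodPair}

/-- The data of the integral computation: an antiderivative of `-h` in the dilated cell, with a
radius beyond which it is exactly `(2 M + 1)`-to-one. -/
lemma exists_invSigma {h g : ℂ → ℂ} {M : ℕ} (hg : DifferentiableOn ℂ g (twoOmega L))
    (heven : ∀ z, g (-z) = g z) (hg0 : g 0 ≠ 0) (hh : ∀ z, z ≠ 0 → h z = g z / z ^ (2 * (M + 1))) :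
    ∃ S : ℂ → ℂ, IsInvSigma (twoOmega L) 0 h S ∧ ∃ R₀ : ℝ, 0 < R₀ ∧
      (∀ z ∈ cell L (3 / 4), z ≠ 0 → R₀ < ‖S z‖ → z ∈ cell L (1 / 4)) ∧
      (∀ w, R₀ < ‖w‖ → {z | z ∈ cell L (3 / 4) ∧ z ≠ 0 ∧ S z = w}.encard = (2 * M + 1 : ℕ)) ∧
      ∀ᶠ z in 𝓝[≠] 0, R₀ < ‖S z‖ := by
  have hopen : IsOpen (twoOmega L) := isOpen_cell 1
  have h0 : (0 : ℂ) ∈ twoOmega L := zero_mem_cell one_pos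
  obtain ⟨Q, hQ, hQ0, hQd⟩ := exists_primitive_of_even hopen (convex_cell 1) h0 M (g := fun z => -g z)
    hg.neg (fun z _ => by rw [heven])
  have hQ0' : Q 0 ≠ 0 := by
    intro h
    rw [h, mul_zero, neg_neg] at hQ0
    exact hg0 hQ0.symm
  have hQa : AnalyticAt ℂ Q 0 := hQ.analyticAt (hopen.mem_nhds h0)
  have hd : IsInvSigma (twoOmega L) 0 h (fun z => Q z / z ^ (2 * M + 1)) := fun z hz hz0 => by
    rw [hh z hz0, ← neg_div]
    exact hQd z hz hz0
  refine ⟨_, hd, ?_⟩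
  obtain ⟨R₀, hR₀, h1, h2⟩ := exists_radius_encard_eq (N := 2 * M + 1) (by omega)
    (S := fun z => Q z / z ^ (2 * M + 1)) hQa hQ0'
    (Eventually.of_forall fun _ => rfl) (cell_mem_nhds (L := L) (r := 3 / 4) (by norm_num))
    (cell_mem_nhds (L := L) (r := 1 / 4) (by norm_num)) (fun O hO hOo => by
      have hcomp : IsCompact (closedCell L (3 / 4) \ O) := (isCompact_closedCell _).diff hOo
      obtain ⟨B, hB⟩ := hcomp.exists_bound_of_continuousOn
        (f := fun z => Q z / z ^ (2 * M + 1)) fun z hz =>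
          (hd z (closedCell_subset_cell (by norm_num) hz.1) fun hz0 =>
            hz.2 (hz0 ▸ mem_of_mem_nhds hO)).continuousAt.continuousWithinAt
      exact ⟨B, fun z hz => hB z ⟨cell_subset_closedCell _ hz.1, hz.2⟩⟩)
  refine ⟨R₀, hR₀, h1, h2, ?_⟩
  -- Off the origin positivity of this function means `‖S z‖ > R₀`, and at the origin it equals `‖Q
  -- 0‖ > 0`.
  have hcont : ContinuousAt (fun z => ‖Q z‖ - R₀ * ‖z‖ ^ (2 * M + 1)) 0 := by
    have := hQa.continuousAt
    fun_prop
  have hpos : ∀ᶠ z in 𝓝 (0 : ℂ), 0 < ‖Q z‖ - R₀ * ‖z‖ ^ (2 * M + 1) :=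
    hcont.eventually (lt_mem_nhds (by simpa using hQ0'))
  filter_upwards [nhdsWithin_le_nhds hpos, self_mem_nhdsWithin] with z hz hz0
  have hz0' : z ≠ 0 := hz0
  rw [norm_div, norm_pow, lt_div_iff₀ (pow_pos (norm_pos_iff.2 hz0') _)]
  linarith

end TorusVortex

theorem mainTheorem6 (L : PeriodPair) (G H : ℂ → ℝ) (hG : IsGreenFunction L G H)
    (V J I : Finset ℂ) (m : ℂ → ℕ) (n : ℕ)
    (hper : IsPeriodicConfiguration L V m) (heven : IsEvenConfiguration L V m)
    (h0 : (0 : ℂ) ∈ V) (hn : m 0 = n)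
    (hhalf : ∀ p ∈ V, p = L.ω₁ / 2 ∨ p = L.ω₂ / 2 ∨ p = (L.ω₁ + L.ω₂) / 2 → Even (m p))
    (hJ : IsRepresentatives L V J) (hI : IsHalfRepresentatives L J I)
    (hbalance : n + ∑ j ∈ J, m j = 2 * (n + 1)) :
    -- the explicit product has the prescribed modulus on the whole plane
    (∀ z : ℂ, z ∉ L.lattice → (∀ j ∈ J, z - j ∉ L.lattice) →
      ‖explicitH L G H n J I m z‖ ^ 2 = weight G n 0 J m id z) ∧
    -- up to a rotation it is the only meromorphic function in the cell with this modulus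
    (∀ K : ℂ → ℂ, IsHZero L G n 0 J m id K ↔
      ∃ c : ℂ, ‖c‖ = 1 ∧ ∀ z ∈ Omega L, z ≠ 0 → K z = c * explicitH L G H n J I m z) ∧
    -- its antiderivative is single-valued in the dilated cell
    (∃ S : ℂ → ℂ, IsInvSigma (twoOmega L) 0 (explicitH L G H n J I m) S) ∧
    -- the coefficient does not depend on the small translation and is given by the area formula
    ∃ D : ℝ,
      IsCoefficient L G n 0 J m id D ∧
      (∃ δ : ℝ, 0 < δ ∧ ∀ τ ∈ Omega L, ‖τ‖ < δ → ∀ p : ℂ → ℂ,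
        (∀ j ∈ J, p j ∈ Omega L ∧ p j - (j + τ) ∈ L.lattice) →
          IsCoefficient L G n τ J m p D) ∧
      ∀ S : ℂ → ℂ, IsInvSigma (Omega L) 0 (explicitH L G H n J I m) S →
        ∀ᶠ ρ : ℝ in 𝓝[>] 0,
          areaWithMultiplicity S (truncated L 0 S ρ) ≠ ⊤ ∧
          Real.pi * D = (areaWithMultiplicity S (truncated L 0 S ρ)).toReal -
            ((n : ℝ) + 1) * volume.real (Metric.ball (0 : ℂ) (1 / ρ)) := by
  have hw := fun z hz hzJ => norm_sq_explicitH (z := z) hG hper heven hhalf hJ hI hbalance hz hzJ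
  obtain ⟨g, hg, hgeven, hg0, hgz⟩ := exists_explicitH_eq_div (L := L) (J := J) (I := I) (m := m)
    (n := n) (G := G) (H := H)
  obtain ⟨M, hM⟩ : ∃ M, ∑ k ∈ I, reducedMult L m k = M + 1 := by
    have := two_mul_sum_reducedMult hper heven hhalf hJ hI hbalance
    exact ⟨∑ k ∈ I, reducedMult L m k - 1, by omega⟩
  have hnM : n + 1 = 2 * M + 1 := by
    have := two_mul_sum_reducedMult hper heven hhalf hJ hI hbalance
    omega
  rw [hM] at hgz
  have hhper := fun z l (hl : l ∈ L.lattice) =>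
    explicitH_add_lattice (J := J) (I := I) (m := m) (n := n) (G := G) (H := H) z hl
  have hdiff := differentiableOn_explicitH (L := L) (J := J) (I := I) (m := m) (n := n) (G := G)
    (H := H)
  set h := explicitH L G H n J I m with hh
  obtain ⟨S₀, hS₀, R₀, hR₀, hV, hN, hinf⟩ := exists_invSigma hg hgeven hg0 hgz
  have hmer : MeromorphicAt h 0 := by
    have hga : AnalyticAt ℂ g 0 := hg.analyticAt (cell_mem_nhds one_pos)
    refine (hga.meromorphicAt.div ((MeromorphicAt.id 0).pow (2 * (M + 1)))).congr ?_
    filter_upwards [self_mem_nhdsWithin] with z hz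
    exact (hgz z hz).symm
  have h0Ω : (0 : ℂ) ∈ Omega L := zero_mem_cell (by norm_num)
  have h0p : ∀ j ∈ J, id j ∈ closure (Omega L) ∧ id j - (j + 0) ∈ L.lattice := fun j hj =>
    ⟨hper.mem_closure j (hJ.subset hj), by simp⟩
  have hsub : twoOmega L \ {0} ⊆ (L.lattice : Set ℂ)ᶜ := fun z hz hzl =>
    hz.2 (eq_zero_of_mem_lattice_of_mem_cell hzl hz.1)
  -- The weight is an exponential, so the zeros of `h` can only lie in `J + Λ`, which is countable.
  have hcrit : {z | z ∈ twoOmega L \ {0} ∧ h z = 0}.Countable := by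
    have hc : (⋃ j ∈ J, (fun l => l + j) '' (L.lattice : Set ℂ)).Countable :=
      J.countable_toSet.biUnion fun j _ =>
        (Set.countable_coe_iff.1 (inferInstanceAs (Countable L.lattice))).image _
    refine hc.mono fun z hz => ?_
    by_contra hz'
    have := hw z (hsub hz.1) fun j hj hl => hz'
      (Set.mem_biUnion (Finset.mem_coe.2 hj) ⟨z - j, hl, sub_add_cancel z j⟩)
    rw [hz.2, norm_zero, zero_pow two_ne_zero, weight] at this
    exact absurd this (Real.exp_pos _).ne
  -- What remains after removing `(n + 1) π R²` from the truncated integral; the coefficient is `B /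
  -- π`.
  set B := (∫ z in {z | z ∈ Omega L ∧ z ≠ 0 ∧ ‖S₀ z‖ ≤ R₀}, ‖h z‖ ^ 2) -
    (n + 1) * (Real.pi * R₀ ^ 2) with hB
  have hint : ∀ τ ∈ cell L (1 / 4), ∀ c d : ℂ, ∀ R : ℝ, ‖c‖ = 1 → R₀ + ‖d‖ < R →
      MeasurableSet {z | z + τ ∈ Omega L ∧ z ≠ 0 ∧ ‖c * S₀ z + d‖ ≤ R} ∧
      IntegrableOn (fun z => ‖h z‖ ^ 2) {z | z + τ ∈ Omega L ∧ z ≠ 0 ∧ ‖c * S₀ z + d‖ ≤ R} ∧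
      ∫ z in {z | z + τ ∈ Omega L ∧ z ≠ 0 ∧ ‖c * S₀ z + d‖ ≤ R}, ‖h z‖ ^ 2 =
        B + (n + 1) * (Real.pi * R ^ 2) := by
    intro τ hτ c d R hc hR
    obtain ⟨i1, i2, i3⟩ := integral_truncated hhper (hdiff.continuousOn.mono hsub) hS₀ hcrit hR₀ hV
      hN hinf hτ hc hR
    refine ⟨i1, i2, ?_⟩
    have hcast : ((2 * M + 1 : ℕ) : ℝ) = n + 1 := by
      rw [← hnM]
      push_cast
      rfl
    rw [i3, hB, hcast]
    ring
  have h014 : (0 : ℂ) ∈ cell L (1 / 4) := zero_mem_cell (by norm_num)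
  refine ⟨hw, fun K => ?_, ⟨S₀, hS₀⟩, 1 / Real.pi * B, ?_, ?_, ?_⟩
  · simpa using isHZero_iff (K := K) hG.periodic hdiff hmer hw h0Ω h0p
  · exact isCoefficient_translate hG.periodic hdiff hmer hw h0Ω h0p hS₀ (hint 0 h014)
  · obtain ⟨δ, hδ, hball⟩ := Metric.mem_nhds_iff.1 (cell_mem_nhds (L := L) (r := 1 / 4) (by norm_num))
    exact ⟨δ, hδ, fun τ hτ hτδ p hp => isCoefficient_translate hG.periodic hdiff hmer hw hτ
      (fun j hj => ⟨subset_closure (hp j hj).1, (hp j hj).2⟩) hS₀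
      (hint τ (hball (mem_ball_zero_iff.2 hτδ)))⟩
  · intro S hS
    have hopenΩ : IsOpen (Omega L) := isOpen_cell _
    have hopen : IsOpen (Omega L \ {0}) := hopenΩ.sdiff isClosed_singleton
    have hΩ2 : Omega L ⊆ twoOmega L := cell_mono (by norm_num)
    obtain ⟨d, hd⟩ := exists_eq_add_const hopen
      (isPreconnected_sdiff_singleton hopenΩ (convex_cell _) 0)
      (fun z hz => hS z hz.1 hz.2) (fun z hz => hS₀ z (hΩ2 hz.1) hz.2)
    have hlarge : ∀ᶠ ρ : ℝ in 𝓝[>] 0, R₀ + ‖d‖ < ρ⁻¹ :=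
      tendsto_inv_nhdsGT_zero.eventually_gt_atTop _
    filter_upwards [hlarge, self_mem_nhdsWithin] with ρ hρR hρ
    have hρ' : 0 < ρ := hρ
    rw [← one_div] at hρR
    -- No rotation is involved, as `h` itself is fixed and only the constant of integration varies.
    obtain ⟨i1, i2, i3⟩ := hint 0 h014 1 d (1 / ρ) norm_one hρR
    have hset : {z | z + 0 ∈ Omega L ∧ z ≠ 0 ∧ ‖1 * S₀ z + d‖ ≤ 1 / ρ} = truncated L 0 S ρ := by
      ext z
      simp only [truncated, Set.mem_ofPred_eq, add_zero, one_mul]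
      exact and_congr_right fun h1 => and_congr_right fun h2 => by rw [hd z ⟨h1, h2⟩]
    rw [hset] at i1 i2 i3
    have hcrit' : {z | z ∈ Omega L \ {0} ∧ -h z = 0}.Countable :=
      hcrit.mono (by rintro z ⟨hz, hz0⟩; exact ⟨⟨hΩ2 hz.1, hz.2⟩, neg_eq_zero.1 hz0⟩)
    have harea : areaWithMultiplicity S (truncated L 0 S ρ) =
        ENNReal.ofReal (∫ z in truncated L 0 S ρ, ‖h z‖ ^ 2) := by
      rw [areaWithMultiplicity_eq_lintegral hopen (f' := fun z => -h z)
        (fun z hz => hS z hz.1 hz.2)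
        hcrit' i1
        (fun z hz => ⟨hz.1, hz.2.1⟩),
        ofReal_integral_eq_lintegral_ofReal i2 (Eventually.of_forall fun z => by positivity)]
      simp only [norm_neg]
    refine ⟨by rw [harea]; exact ENNReal.ofReal_ne_top, ?_⟩
    rw [harea, ENNReal.toReal_ofReal (integral_nonneg fun z => by positivity), i3,
      volume_real_ball 0 (by positivity)]
    have := Real.pi_ne_zero
    field_simp
    ring
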